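/- **Theorem (Privacy with client sampling).** There exist absolute constants $c_1, c_2 > 0$ such that the following holds. Let $N$ be a number of users, $T$ a number of rounds, $m_i \ge 1$ the minibatch size of user $i$, $M = \sum_{i=1}^N m_i$, and let $f_i(w,\theta,\xi)$, $w \in \mathbb{R}^{d_w}$, $\theta \in \mathbb{R}^{d_\theta}$, be losses that are differentiable in $(w,\theta)$ for every sample $\xi$. User $i$ holds private data $D_i = (\xi_{i,t}^{(k)})_{1\le t\le T,\,1\le k\le m_i}$. Consider the following algorithm (personalized private SGD with client sampling) with sampling probability $q \in (0,1]$, step size $\eta$, global/local ratio $\alpha$, noise level $\sigma_\zeta$ and clipping parameter $C > 0$: start from $w_0 = 0$, $\theta_{i,0} = 0$; at each round $t = 1,\dots,T$ draw $b_{i,t} \sim \mathrm{Ber}(q)$ for $i=1,\dots,N$ and $\zeta_t \sim \mathcal N(0,\sigma_\zeta^2 I_{d_w})$, all independent. For each $i$ with $b_{i,t}=1$ put $$g_{\theta,i}^t = \sum_{k=1}^{m_i}\nabla_\theta f_i(w_{t-1},\theta_{i,t-1},\xi_{i,t}^{(k)}),\quad g_{w,i}^t = \sum_{k=1}^{m_i}\nabla_w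 f_i(w_{t-1},\theta_{i,t-1},\xi_{i,t}^{(k)}),\quad \tilde g_{w,i}^t = \frac{g_{w,i}^t}{\max(1,\|g_{w,i}^t\|/C)},$$ $$\theta_{i,t} = \theta_{i,t-1} - \frac{\eta}{qM}\, g_{\theta,i}^t,$$ while $\theta_{i,t}=\theta_{i,t-1}$ if $b_{i,t}=0$, and update $$w_t = w_{t-1} - \alpha\eta\Big(\frac{1}{qM}\sum_{i:\,b_{i,t}=1}\tilde g_{w,i}^t + \zeta_t\Big).$$ The output that user $j$ receives consists of the global models $(w_t)_{0\le t\le T}$ and of its own local models $(\theta_{j,t})_{0\le t\le T}$. Let $0<\delta<1$ and $0 < \varepsilon \le \log(1/\delta)$. If $\varepsilon < c_1 q^2 T$ and $$\sigma_\zeta \ge c_2\,\frac{C\sqrt{T\log(1/\delta)}}{M\varepsilon},$$ then the algorithm is $(\varepsilon,\delta)$-jointly differentially private (JDP): for every user $i$, all datasets $D, D'$ that differ only in the data of user $i$, and every event $E$ in the space of the outputs to all users except $i$, writing $\mathcal A_{-i}(D)$ for these outputs, $$\Pr[\mathcal A_{-i}(D)\in E] \le e^{\varepsilon}\,\Pr[\mathcal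 A_{-i}(D')\in E] + \delta .$$ -/

import Mathlib

open MeasureTheory ProbabilityTheory
open scoped Gradient

noncomputable section

/-- `(ε, δ)`-joint differential privacy of a randomized mechanism.
User `i` owns private data in `𝒟 i` and receives an output in `O i`. The mechanism maps a dataset
`D` and random coins `ω`, drawn from `P`, to the outputs of all the users.
For every user `i` and all datasets `D, D'` which differ only in the data of user `i`, the outputs
to all the users *except* `i` satisfy the `(ε, δ)`-indistinguishability inequality, for every
measurable event in the joint output space of these other users. -/
def IsJDP {ι Ω : Type*} {𝒟 O : ι → Type*} [MeasurableSpace Ω] [∀ i, MeasurableSpace (O i)]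
    (ε δ : ℝ) (P : Measure Ω) (mech : (∀ i, 𝒟 i) → Ω → ∀ i, O i) : Prop :=
  ∀ (i : ι) (D D' : ∀ j, 𝒟 j), (∀ j, j ≠ i → D j = D' j) →
    ∀ E : Set (∀ j : {j : ι // j ≠ i}, O j), MeasurableSet E →
      P {ω | (fun j : {j : ι // j ≠ i} => mech D ω j) ∈ E} ≤
        ENNReal.ofReal (Real.exp ε) *
            P {ω | (fun j : {j : ι // j ≠ i} => mech D' ω j) ∈ E} +
          ENNReal.ofReal δ

/-- The inputs of personalized private SGD with client sampling, for `N` users, `T` rounds,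
a global parameter in `ℝ^dw`, local parameters in `ℝ^dθ` and samples in `Ξ`. -/
structure PPSGD (N T dw dθ : ℕ) (Ξ : Type*) where
  /-- `loss i w θ ξ` is the loss `f_i(w, θ, ξ)` of user `i` -/
  loss : Fin N → EuclideanSpace ℝ (Fin dw) → EuclideanSpace ℝ (Fin dθ) → Ξ → ℝ
  /-- client sampling probability -/
  q : unitInterval
  /-- minibatch sizes -/
  m : Fin N → ℕ
  /-- step size -/
  η : ℝ
  /-- global/local ratio -/
  α : ℝ
  /-- privacy noise level (a standard deviation) -/
  σζ : ℝ
  /-- clipping parameter -/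
  C : ℝ

namespace PPSGD

variable {N T dw dθ : ℕ} {Ξ : Type*} (A : PPSGD N T dw dθ Ξ)

/-- The total minibatch size `M = ∑ i, m i`. -/
def M : ℕ := ∑ i, A.m i

/-- The private data of user `i`: the samples `ξ_{i,t}^{(k)}`, `1 ≤ k ≤ m i`, which the user has
available for each round `t`. -/
abbrev Data (i : Fin N) : Type _ := Fin T → Fin (A.m i) → Ξ

/-- The iterate `(w_t, (θ_{1,t}, …, θ_{N,t}))`. -/
abbrev State (_ : PPSGD N T dw dθ Ξ) : Type :=
  EuclideanSpace ℝ (Fin dw) × (Fin N → EuclideanSpace ℝ (Fin dθ))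

/-- The random coins of all rounds: the participation bits `b_{i,t}` (as `b t i`)
and the noise vectors `ζ_t`. -/
abbrev Coins (_ : PPSGD N T dw dθ Ξ) : Type :=
  (Fin T → Fin N → Bool) × (Fin T → EuclideanSpace ℝ (Fin dw))

/-- The law of the coins: all independent, `b_{i,t} ∼ Ber(q)` and `ζ_t ∼ 𝒩(0, σζ² I)`. -/
def coinLaw : Measure A.Coins :=
  (Measure.pi fun _ : Fin T => Measure.pi fun _ : Fin N => bernoulliMeasure true false A.q).prod
    (Measure.pi fun _ : Fin T => multivariateGaussian 0 (A.σζ ^ 2 • 1))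

/-- Minibatch gradient of user `i` with respect to the global parameter. -/
def gradW (i : Fin N) (w : EuclideanSpace ℝ (Fin dw)) (θ : EuclideanSpace ℝ (Fin dθ))
    (ξ : Fin (A.m i) → Ξ) : EuclideanSpace ℝ (Fin dw) :=
  ∑ k, ∇ (fun w' => A.loss i w' θ (ξ k)) w

/-- Minibatch gradient of user `i` with respect to the local parameter. -/
def gradθ (i : Fin N) (w : EuclideanSpace ℝ (Fin dw)) (θ : EuclideanSpace ℝ (Fin dθ))
    (ξ : Fin (A.m i) → Ξ) : EuclideanSpace ℝ (Fin dθ) :=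
  ∑ k, ∇ (fun θ' => A.loss i w θ' (ξ k)) θ

/-- Clipping: `g / max(1, ‖g‖ / C)`. -/
def clip (g : EuclideanSpace ℝ (Fin dw)) : EuclideanSpace ℝ (Fin dw) :=
  (max 1 (‖g‖ / A.C))⁻¹ • g

/-- One round, with minibatches `ξ`, participation bits `b` and noise `ζ`. -/
def step (ξ : ∀ i, Fin (A.m i) → Ξ) (b : Fin N → Bool) (ζ : EuclideanSpace ℝ (Fin dw))
    (z : A.State) : A.State :=
  (z.1 - (A.α * A.η) • ((1 / ((A.q : ℝ) * A.M)) •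
      (∑ i with b i = true, A.clip (A.gradW i z.1 (z.2 i) (ξ i))) + ζ),
    fun i => if b i = true then
        z.2 i - (A.η / ((A.q : ℝ) * A.M)) • A.gradθ i z.1 (z.2 i) (ξ i)
      else z.2 i)

/-- The iterates, for `t = 0, …, T`, started at `w_0 = 0`, `θ_{i,0} = 0`. -/
def iterate (D : ∀ i, A.Data i) (ω : A.Coins) (t : Fin (T + 1)) : A.State :=
  Fin.induction (motive := fun _ => A.State) 0
    (fun s z => A.step (fun i => D i s) (ω.1 s) (ω.2 s) z) t

/-- What a user receives: all the broadcast global models `w_0, …, w_T` and all of the user's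
own local models `θ_{i,0}, …, θ_{i,T}`. -/
abbrev Output (_ : PPSGD N T dw dθ Ξ) (_ : Fin N) : Type :=
  (Fin (T + 1) → EuclideanSpace ℝ (Fin dw)) × (Fin (T + 1) → EuclideanSpace ℝ (Fin dθ))

/-- The whole algorithm, as a mechanism with one output per user. -/
def run (D : ∀ i, A.Data i) (ω : A.Coins) (i : Fin N) : A.Output i :=
  (fun t => (A.iterate D ω t).1, fun t => (A.iterate D ω t).2 i)

end PPSGD

end

/-! Fix the user `i` whose data changes. In a round, this user acts on what the others see only by
shifting the Gaussian noise, with probability q, by its clipped contribution, of norm at most Δ =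
C/(qM). The usual moments accountant does not apply directly: the local model of user `i` is never
revealed and depends on past participation, so given the public transcript the shift is itself
random.

The remedy is to carry a finite family of possible hidden local models with unnormalised weights,
which doubles in every round (participate or not). Cameron–Martin,
`lintegral_gaussianShiftDensity_mul`, moves the shift from the state into the weight; then all
hidden histories share the same next public state, and the total weight is the likelihood of the
transcript. A round multiplies it by p = 1 - q + qR, where R is the density of a mixture of
Gaussians with shifts of norm at most Δ.

Everything thus rests on one round with two arbitrary mixtures R, R'. Let P, Q have densities p, p',
and κ = Δ²/σ². By `subsampledMoment_le`, E_Q (P/Q)^l ≤ exp(12 q² κ l²) if 9κl ≤ 1. This goes by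
induction on the order: with φ = (p/p')^n, the step from n to n + 1 costs E_P φ - E_Q φ = q(E_R φ -
E_{R'} φ). Means under R and R' are averages over translates of length at most Δ. A translation
changes φ by a relative amount of order n q (e^κ - 1)(R/p + R'/p'), where the last factor is bounded
on average. The two factors q give the amplification by sampling.

`sum_trajectoryMean_le` integrates m'(m/m')^(l+1), for the two likelihoods m, m', through the rounds
and concludes by a Markov inequality. Since Δ contains 1/q, the exponent 12 q² κ (l+1)² T does not
depend on q; the condition ε < q² T keeps moments of order about log(1/δ)/ε admissible. -/

noncomputable section

/-! ### Cameron–Martin formula for isotropic Gaussians -/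

section GaussianShift

open scoped ENNReal NNReal

theorem lintegral_pi_prod {ι : Type*} [Fintype ι] {X : ι → Type*} [∀ i, MeasurableSpace (X i)]
    (μ : ∀ i, Measure (X i)) [∀ i, IsProbabilityMeasure (μ i)] (f : ∀ i, X i → ℝ≥0∞)
    (hf : ∀ i, Measurable (f i)) :
    ∫⁻ x, ∏ i, f i (x i) ∂Measure.pi μ = ∏ i, ∫⁻ y, f i y ∂μ i := by
  have hind : iIndepFun (fun i (x : ∀ i, X i) => f i (x i)) (Measure.pi μ) :=
    iIndepFun_pi (μ := μ) (X := f) fun i => (hf i).aemeasurable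
  have h := lintegral_prod_eq_prod_lintegral_of_indepFun (μ := Measure.pi μ) Finset.univ
    (fun i (x : ∀ i, X i) => f i (x i)) hind (fun i => (hf i).comp (measurable_pi_apply i))
  rw [h]
  refine Finset.prod_congr rfl fun i _ => ?_
  exact (measurePreserving_eval μ i).lintegral_comp (hf i)

theorem pi_withDensity {ι : Type*} [Fintype ι] {X : ι → Type*} [∀ i, MeasurableSpace (X i)]
    (μ : ∀ i, Measure (X i)) [∀ i, IsProbabilityMeasure (μ i)] (f : ∀ i, X i → ℝ≥0∞)
    (hf : ∀ i, Measurable (f i)) [∀ i, SigmaFinite ((μ i).withDensity (f i))] :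
    (Measure.pi μ).withDensity (fun x => ∏ i, f i (x i)) =
      Measure.pi fun i => (μ i).withDensity (f i) := by
  refine (Measure.pi_eq fun s hs => ?_).symm
  rw [withDensity_apply _ (MeasurableSet.univ_pi hs), ← lintegral_indicator (MeasurableSet.univ_pi hs)]
  have h : (fun x : ∀ i, X i => (Set.univ.pi s).indicator (fun x => ∏ i, f i (x i)) x) =
      fun x => ∏ i, (s i).indicator (f i) (x i) := by
    funext x
    by_cases hx : x ∈ Set.univ.pi s
    · rw [Set.indicator_of_mem hx]
      exact Finset.prod_congr rfl fun i _ => (Set.indicator_of_mem (hx i trivial) _).symm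
    · rw [Set.indicator_of_notMem hx]
      simp only [Set.mem_univ_pi, not_forall] at hx
      obtain ⟨i, hi⟩ := hx
      exact (Finset.prod_eq_zero (Finset.mem_univ i) (Set.indicator_of_notMem hi _)).symm
  rw [h, lintegral_pi_prod μ _ fun i => (hf i).indicator (hs i)]
  refine Finset.prod_congr rfl fun i _ => ?_
  rw [lintegral_indicator (hs i), withDensity_apply _ (hs i)]

theorem gaussianReal_withDensity_exp (u : ℝ) {v : ℝ≥0} (hv : v ≠ 0) :
    (gaussianReal 0 v).withDensity
        (fun y => ENNReal.ofReal (Real.exp ((u * y - u ^ 2 / 2) / v))) = gaussianReal u v := by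
  have hv' : (v : ℝ) ≠ 0 := by exact_mod_cast hv
  rw [gaussianReal_of_var_ne_zero _ hv, gaussianReal_of_var_ne_zero _ hv,
    ← withDensity_mul _ (measurable_gaussianPDF _ _) (by fun_prop)]
  congr 1
  funext y
  simp only [Pi.mul_apply, gaussianPDF]
  rw [← ENNReal.ofReal_mul (gaussianPDFReal_nonneg _ _ _)]
  congr 1
  simp only [gaussianPDFReal]
  rw [mul_assoc, ← Real.exp_add]
  congr 2
  field_simp
  ring

/-- The characteristic functions agree. The product form reduces Cameron–Martin to one coordinate.
-/
theorem multivariateGaussian_smul_one_eq_map_pi {d : ℕ} (σ : ℝ) :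
    multivariateGaussian (0 : EuclideanSpace ℝ (Fin d)) (σ ^ 2 • 1) =
      (Measure.pi fun _ : Fin d => gaussianReal 0 (σ ^ 2).toNNReal).map (WithLp.toLp 2) := by
  apply Measure.ext_of_charFun
  ext t
  have hS : (σ ^ 2 • (1 : Matrix (Fin d) (Fin d) ℝ)).PosSemidef :=
    Matrix.PosSemidef.one.smul (sq_nonneg σ)
  rw [charFun_multivariateGaussian hS]
  simp_rw [charFun_pi, charFun_gaussianReal, ← Complex.exp_sum]
  congr 1
  simp only [inner_zero_right, Complex.ofReal_zero, zero_mul, zero_sub, Matrix.smul_mulVec,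
    Matrix.one_mulVec, dotProduct, Real.coe_toNNReal _ (sq_nonneg σ), mul_zero]
  rw [Finset.sum_neg_distrib, ← Finset.sum_div]
  congr 2
  push_cast
  refine Finset.sum_congr rfl fun i _ => ?_
  simp
  ring

/-- The density of `𝒩(u, σ² I)` with respect to `𝒩(0, σ² I)`. -/
def gaussianShiftDensity {d : ℕ} (σ : ℝ) (u y : EuclideanSpace ℝ (Fin d)) : ℝ :=
  Real.exp ((inner ℝ u y - ‖u‖ ^ 2 / 2) / σ ^ 2)

theorem measurable_gaussianShiftDensity {d : ℕ} (σ : ℝ) (u : EuclideanSpace ℝ (Fin d)) :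
    Measurable (gaussianShiftDensity σ u) := by
  unfold gaussianShiftDensity
  fun_prop

/-- The Cameron–Martin formula for `𝒩(0, σ² I)`. -/
theorem lintegral_gaussianShiftDensity_mul {d : ℕ} {σ : ℝ} (hσ : σ ≠ 0)
    (u : EuclideanSpace ℝ (Fin d)) {f : EuclideanSpace ℝ (Fin d) → ℝ≥0∞} (hf : Measurable f) :
    ∫⁻ y, ENNReal.ofReal (gaussianShiftDensity σ u y) * f y
        ∂multivariateGaussian 0 (σ ^ 2 • 1) =
      ∫⁻ y, f (y + u) ∂multivariateGaussian 0 (σ ^ 2 • 1) := by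
  have hv : (σ ^ 2).toNNReal ≠ 0 := by
    simpa using hσ
  set v := (σ ^ 2).toNNReal with hvdef
  have hvσ : (v : ℝ) = σ ^ 2 := Real.coe_toNNReal _ (sq_nonneg σ)
  have hme : Measurable (WithLp.toLp 2 : (Fin d → ℝ) → EuclideanSpace ℝ (Fin d)) := by fun_prop
  rw [multivariateGaussian_smul_one_eq_map_pi, ← hvdef,
    lintegral_map (f := fun y => ENNReal.ofReal (gaussianShiftDensity σ u y) * f y)
      (((measurable_gaussianShiftDensity σ u).ennreal_ofReal).mul hf) hme,
    lintegral_map (by fun_prop) hme]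
  have hdens : ∀ i, (gaussianReal 0 v).withDensity
      (fun y => ENNReal.ofReal (Real.exp ((u i * y - u i ^ 2 / 2) / v))) = gaussianReal (u i) v :=
    fun i => gaussianReal_withDensity_exp (u i) hv
  have : ∀ i, SigmaFinite ((gaussianReal 0 v).withDensity
      (fun y => ENNReal.ofReal (Real.exp ((u i * y - u i ^ 2 / 2) / v)))) := fun i => by
    rw [hdens]; infer_instance
  have key := pi_withDensity (fun _ : Fin d => gaussianReal 0 v)
    (fun i y => ENNReal.ofReal (Real.exp ((u i * y - u i ^ 2 / 2) / v))) (fun i => by fun_prop)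
  simp only [hdens] at key
  have hmap : Measure.pi (fun i => gaussianReal (u i) v) =
      (Measure.pi fun _ : Fin d => gaussianReal 0 v).map (fun x i => x i + u i) := by
    have h := Measure.pi_map_pi (μ := fun _ : Fin d => gaussianReal 0 v)
      (f := fun i y => y + u i) (fun i => by fun_prop)
    rw [h]
    congr 1
    funext i
    rw [gaussianReal_map_add_const, zero_add]
  have hprod : ∀ x : Fin d → ℝ, ENNReal.ofReal (gaussianShiftDensity σ u (WithLp.toLp 2 x)) =
      ∏ i, ENNReal.ofReal (Real.exp ((u i * x i - u i ^ 2 / 2) / v)) := by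
    intro x
    rw [← ENNReal.ofReal_prod_of_nonneg fun i _ => (Real.exp_pos _).le, ← Real.exp_sum,
      gaussianShiftDensity, ← Finset.sum_div, hvσ, Finset.sum_sub_distrib, ← Finset.sum_div,
      EuclideanSpace.real_norm_sq_eq]
    congr 4
    simp [PiLp.inner_apply, mul_comm]
  simp_rw [hprod]
  have h1 := lintegral_withDensity_eq_lintegral_mul (Measure.pi fun _ : Fin d => gaussianReal 0 v)
    (f := fun x => ∏ i, ENNReal.ofReal (Real.exp ((u i * x i - u i ^ 2 / 2) / v)))
    (Finset.measurable_prod _ fun i _ => by fun_prop) (hf.comp hme)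
  rw [key, hmap, lintegral_map (hf.comp hme) (by fun_prop)] at h1
  exact h1.symm

end GaussianShift

/-! ### Gaussian mixtures: behaviour under translation and inversion -/

section SubsampledGaussian

open scoped ENNReal

variable {d : ℕ} {H H' : Type*} [Fintype H] [Fintype H']

theorem gaussianShiftDensity_pos (σ : ℝ) (u y : EuclideanSpace ℝ (Fin d)) :
    0 < gaussianShiftDensity σ u y :=
  Real.exp_pos _

/-- The log-density is affine in `y`, so a translation costs a factor independent of `y`. All growth
bounds below come from this. -/
theorem gaussianShiftDensity_add (σ : ℝ) (u y v : EuclideanSpace ℝ (Fin d)) :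
    gaussianShiftDensity σ u (y + v) =
      Real.exp (inner ℝ u v / σ ^ 2) * gaussianShiftDensity σ u y := by
  rw [gaussianShiftDensity, gaussianShiftDensity, ← Real.exp_add, inner_add_right]
  congr 1
  ring

theorem inv_gaussianShiftDensity (σ : ℝ) (u y : EuclideanSpace ℝ (Fin d)) :
    (gaussianShiftDensity σ u y)⁻¹ =
      Real.exp (‖u‖ ^ 2 / σ ^ 2) * gaussianShiftDensity σ (-u) y := by
  rw [gaussianShiftDensity, gaussianShiftDensity, ← Real.exp_neg, ← Real.exp_add, inner_neg_left,
    norm_neg]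
  congr 1
  ring

/-- The density, with respect to `𝒩(0, σ² I)`, of a mixture of the `𝒩(u h, σ² I)`. -/
def mixtureDensity (σ : ℝ) (a : H → ℝ) (u : H → EuclideanSpace ℝ (Fin d))
    (y : EuclideanSpace ℝ (Fin d)) : ℝ :=
  ∑ h, a h * gaussianShiftDensity σ (u h) y

/-- The density, with respect to `𝒩(0, σ² I)`, of `𝒩(0, σ² I)` with weight `1 - s` and of a
mixture of shifts of it with weight `s`. -/
def subsampledDensity (s σ : ℝ) (a : H → ℝ) (u : H → EuclideanSpace ℝ (Fin d))
    (y : EuclideanSpace ℝ (Fin d)) : ℝ :=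
  1 - s + s * mixtureDensity σ a u y

theorem measurable_mixtureDensity (σ : ℝ) (a : H → ℝ) (u : H → EuclideanSpace ℝ (Fin d)) :
    Measurable (mixtureDensity σ a u) :=
  Finset.measurable_sum _ fun _ _ => (measurable_gaussianShiftDensity _ _).const_mul _

theorem measurable_subsampledDensity (s σ : ℝ) (a : H → ℝ) (u : H → EuclideanSpace ℝ (Fin d)) :
    Measurable (subsampledDensity s σ a u) :=
  ((measurable_mixtureDensity σ a u).const_mul s).const_add _

theorem mixtureDensity_pos {σ : ℝ} {a : H → ℝ} (ha : ∀ h, 0 ≤ a h) (ha1 : ∑ h, a h = 1)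
    (u : H → EuclideanSpace ℝ (Fin d)) (y : EuclideanSpace ℝ (Fin d)) :
    0 < mixtureDensity σ a u y := by
  obtain ⟨h, -, hh⟩ : ∃ h ∈ Finset.univ, 0 < a h := by
    by_contra! hc
    have := Finset.sum_nonpos hc
    linarith
  exact Finset.sum_pos' (fun h _ => mul_nonneg (ha h) (gaussianShiftDensity_pos _ _ _).le)
    ⟨h, Finset.mem_univ h, mul_pos hh (gaussianShiftDensity_pos _ _ _)⟩

theorem subsampledDensity_pos {s σ : ℝ} (hs0 : 0 ≤ s) (hs1 : s ≤ 1) {a : H → ℝ}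
    (ha : ∀ h, 0 ≤ a h) (ha1 : ∑ h, a h = 1) (u : H → EuclideanSpace ℝ (Fin d))
    (y : EuclideanSpace ℝ (Fin d)) :
    0 < subsampledDensity s σ a u y := by
  have := mixtureDensity_pos (σ := σ) ha ha1 u y
  unfold subsampledDensity
  rcases hs0.eq_or_lt with rfl | hs
  · simp
  · have := mul_pos hs this
    linarith

/-- `f` grows at most by the factor `K` under shifts of length at most `Δ`. -/
def ShiftGrowth (Δ K : ℝ) (f : EuclideanSpace ℝ (Fin d) → ℝ) : Prop :=
  ∀ y v, ‖v‖ ≤ Δ → f (y + v) ≤ K * f y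

theorem ShiftGrowth.mul {Δ K L : ℝ} {f g : EuclideanSpace ℝ (Fin d) → ℝ} (hf : ShiftGrowth Δ K f)
    (hg : ShiftGrowth Δ L g) (hK : 0 ≤ K) (hf0 : ∀ y, 0 ≤ f y) (hg0 : ∀ y, 0 ≤ g y) :
    ShiftGrowth Δ (K * L) (fun y => f y * g y) := fun y v hv =>
  (mul_le_mul (hf y v hv) (hg y v hv) (hg0 _) (mul_nonneg hK (hf0 y))).trans_eq (by ring)

theorem ShiftGrowth.pow {Δ K : ℝ} {f : EuclideanSpace ℝ (Fin d) → ℝ} (hf : ShiftGrowth Δ K f)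
    (hf0 : ∀ y, 0 ≤ f y) (n : ℕ) : ShiftGrowth Δ (K ^ n) (fun y => f y ^ n) := fun y v hv =>
  (pow_le_pow_left₀ (hf0 _) (hf y v hv) n).trans_eq (mul_pow _ _ _)

/-- The set of admissible shifts is symmetric, so the growth bound can be read backwards from `y +
v` to `y`. -/
theorem ShiftGrowth.inv {Δ K : ℝ} {f : EuclideanSpace ℝ (Fin d) → ℝ} (hf : ShiftGrowth Δ K f)
    (hf0 : ∀ y, 0 < f y) : ShiftGrowth Δ K (fun y => (f y)⁻¹) := fun y v hv => by
  have h := hf (y + v) (-v) (by rwa [norm_neg])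
  rw [add_neg_cancel_right] at h
  rw [← div_eq_mul_inv, le_div_iff₀ (hf0 _), inv_mul_le_iff₀ (hf0 _), mul_comm]
  exact h

theorem shiftGrowth_mixtureDensity {Δ σ : ℝ} {a : H → ℝ} (ha : ∀ h, 0 ≤ a h)
    {u : H → EuclideanSpace ℝ (Fin d)} (hu : ∀ h, ‖u h‖ ≤ Δ) :
    ShiftGrowth Δ (Real.exp (Δ ^ 2 / σ ^ 2)) (mixtureDensity σ a u) := fun y v hv => by
  rw [mixtureDensity, mixtureDensity, Finset.mul_sum]
  refine Finset.sum_le_sum fun h _ => ?_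
  rw [gaussianShiftDensity_add, mul_left_comm]
  refine mul_le_mul_of_nonneg_right (Real.exp_le_exp.2 ?_)
    (mul_nonneg (ha h) (gaussianShiftDensity_pos _ _ _).le)
  refine div_le_div_of_nonneg_right ?_ (sq_nonneg σ)
  calc inner ℝ (u h) v ≤ ‖u h‖ * ‖v‖ := real_inner_le_norm _ _
    _ ≤ Δ * Δ := mul_le_mul (hu h) hv (norm_nonneg _) ((norm_nonneg _).trans hv)
    _ = Δ ^ 2 := (sq Δ).symm

theorem one_le_exp_sq_div (Δ σ : ℝ) : 1 ≤ Real.exp (Δ ^ 2 / σ ^ 2) :=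
  Real.one_le_exp (by positivity)

theorem shiftGrowth_subsampledDensity {Δ s σ : ℝ} (hs0 : 0 ≤ s) (hs1 : s ≤ 1) {a : H → ℝ}
    (ha : ∀ h, 0 ≤ a h) {u : H → EuclideanSpace ℝ (Fin d)} (hu : ∀ h, ‖u h‖ ≤ Δ) :
    ShiftGrowth Δ (Real.exp (Δ ^ 2 / σ ^ 2)) (subsampledDensity s σ a u) := fun y v hv => by
  have h1 := mul_le_mul_of_nonneg_left (shiftGrowth_mixtureDensity (σ := σ) ha hu y v hv) hs0
  have h2 := mul_le_mul_of_nonneg_right (one_le_exp_sq_div Δ σ) (sub_nonneg.2 hs1)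
  unfold subsampledDensity
  linarith

/-- Expectation of a non-negative function under `𝒩(0, σ² I)`. -/
def gaussianMean (σ : ℝ) (f : EuclideanSpace ℝ (Fin d) → ℝ) : ℝ≥0∞ :=
  ∫⁻ y, ENNReal.ofReal (f y) ∂multivariateGaussian 0 (σ ^ 2 • 1)

theorem gaussianMean_mono {σ : ℝ} {f g : EuclideanSpace ℝ (Fin d) → ℝ} (h : ∀ y, f y ≤ g y) :
    gaussianMean σ f ≤ gaussianMean σ g :=
  lintegral_mono fun y => ENNReal.ofReal_le_ofReal (h y)

theorem gaussianMean_add {σ : ℝ} {f g : EuclideanSpace ℝ (Fin d) → ℝ} (hf : Measurable f)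
    (hf0 : ∀ y, 0 ≤ f y) (hg0 : ∀ y, 0 ≤ g y) :
    gaussianMean σ (fun y => f y + g y) = gaussianMean σ f + gaussianMean σ g := by
  rw [gaussianMean, gaussianMean, gaussianMean, ← lintegral_add_left hf.ennreal_ofReal]
  exact lintegral_congr fun y => ENNReal.ofReal_add (hf0 y) (hg0 y)

theorem gaussianMean_const_mul {σ : ℝ} {f : EuclideanSpace ℝ (Fin d) → ℝ} (hf : Measurable f)
    {c : ℝ} (hc : 0 ≤ c) :
    gaussianMean σ (fun y => c * f y) = ENNReal.ofReal c * gaussianMean σ f := by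
  rw [gaussianMean, gaussianMean, ← lintegral_const_mul _ hf.ennreal_ofReal]
  exact lintegral_congr fun y => ENNReal.ofReal_mul hc

theorem lintegral_mixtureDensity_mul {σ : ℝ} (hσ : σ ≠ 0) {a : H → ℝ} (ha : ∀ h, 0 ≤ a h)
    (u : H → EuclideanSpace ℝ (Fin d)) {F : EuclideanSpace ℝ (Fin d) → ℝ≥0∞} (hF : Measurable F) :
    ∫⁻ y, ENNReal.ofReal (mixtureDensity σ a u y) * F y ∂multivariateGaussian 0 (σ ^ 2 • 1) =
      ∑ h, ENNReal.ofReal (a h) * ∫⁻ y, F (y + u h) ∂multivariateGaussian 0 (σ ^ 2 • 1) := by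
  have h1 : ∀ y, ENNReal.ofReal (mixtureDensity σ a u y) * F y =
      ∑ h, ENNReal.ofReal (a h) * (ENNReal.ofReal (gaussianShiftDensity σ (u h) y) * F y) := by
    intro y
    rw [mixtureDensity, ENNReal.ofReal_sum_of_nonneg
      fun h _ => mul_nonneg (ha h) (gaussianShiftDensity_pos _ _ _).le, Finset.sum_mul]
    exact Finset.sum_congr rfl fun h _ => by rw [ENNReal.ofReal_mul (ha h), mul_assoc]
  have hm : ∀ h, Measurable fun y => ENNReal.ofReal (gaussianShiftDensity σ (u h) y) * F y :=
    fun h => (measurable_gaussianShiftDensity _ _).ennreal_ofReal.mul hF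
  simp_rw [h1]
  rw [lintegral_finsetSum _ fun h _ => (hm h).const_mul _]
  exact Finset.sum_congr rfl fun h _ => by
    rw [lintegral_const_mul _ (hm h), lintegral_gaussianShiftDensity_mul hσ _ hF]

theorem sum_ofReal_mul_const {a : H → ℝ} (ha : ∀ h, 0 ≤ a h) (ha1 : ∑ h, a h = 1) (c : ℝ≥0∞) :
    ∑ h, ENNReal.ofReal (a h) * c = c := by
  rw [← Finset.sum_mul, ← ENNReal.ofReal_sum_of_nonneg fun h _ => ha h, ha1, ENNReal.ofReal_one,
    one_mul]

theorem gaussianMean_mixtureDensity_mul {σ : ℝ} (hσ : σ ≠ 0) {a : H → ℝ} (ha : ∀ h, 0 ≤ a h)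
    (ha1 : ∑ h, a h = 1) (u : H → EuclideanSpace ℝ (Fin d)) {f : EuclideanSpace ℝ (Fin d) → ℝ}
    (hf : Measurable f) :
    gaussianMean σ (fun y => mixtureDensity σ a u y * f y) =
      ∑ h, ENNReal.ofReal (a h) * gaussianMean σ (fun y => f (y + u h)) := by
  rw [gaussianMean]
  simp_rw [ENNReal.ofReal_mul (mixtureDensity_pos ha ha1 u _).le]
  exact lintegral_mixtureDensity_mul hσ ha u hf.ennreal_ofReal

/-- Integration against a mixture is an average of translates, so a pointwise bound over short
translates suffices, whatever the mixture is. -/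
theorem gaussianMean_mixtureDensity_mul_le {σ Δ : ℝ} (hσ : σ ≠ 0) {a : H → ℝ}
    (ha : ∀ h, 0 ≤ a h) (ha1 : ∑ h, a h = 1) {u : H → EuclideanSpace ℝ (Fin d)}
    (hu : ∀ h, ‖u h‖ ≤ Δ)
    {f g : EuclideanSpace ℝ (Fin d) → ℝ} (hf : Measurable f)
    (hfg : ∀ y v, ‖v‖ ≤ Δ → f (y + v) ≤ g y) :
    gaussianMean σ (fun y => mixtureDensity σ a u y * f y) ≤ gaussianMean σ g := by
  rw [gaussianMean_mixtureDensity_mul hσ ha ha1 u hf,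
    ← sum_ofReal_mul_const ha ha1 (gaussianMean σ g)]
  exact Finset.sum_le_sum fun h _ => mul_le_mul_right
    (gaussianMean_mono fun y => hfg y _ (hu h)) _

theorem le_gaussianMean_mixtureDensity_mul {σ Δ : ℝ} (hσ : σ ≠ 0) {a : H → ℝ}
    (ha : ∀ h, 0 ≤ a h) (ha1 : ∑ h, a h = 1) {u : H → EuclideanSpace ℝ (Fin d)}
    (hu : ∀ h, ‖u h‖ ≤ Δ)
    {f g D : EuclideanSpace ℝ (Fin d) → ℝ} (hf : Measurable f) (hf0 : ∀ y, 0 ≤ f y)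
    (hD : ∀ y, 0 ≤ D y)
    (hfg : ∀ y v, ‖v‖ ≤ Δ → g y ≤ f (y + v) + D y) :
    gaussianMean σ g ≤
      gaussianMean σ (fun y => mixtureDensity σ a u y * f y) + gaussianMean σ D := by
  rw [gaussianMean_mixtureDensity_mul hσ ha ha1 u hf,
    ← sum_ofReal_mul_const ha ha1 (gaussianMean σ D), ← sum_ofReal_mul_const ha ha1
      (gaussianMean σ g), ← Finset.sum_add_distrib]
  refine Finset.sum_le_sum fun h _ => ?_
  rw [← mul_add, ← gaussianMean_add (by fun_prop) (fun _ => hf0 _) hD]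
  exact mul_le_mul_right (gaussianMean_mono fun y => hfg y _ (hu h)) _

theorem gaussianMean_subsampledDensity_mul {s σ : ℝ} (hs0 : 0 ≤ s) (hs1 : s ≤ 1)
    {a : H → ℝ} (ha : ∀ h, 0 ≤ a h) (ha1 : ∑ h, a h = 1) (u : H → EuclideanSpace ℝ (Fin d))
    {f : EuclideanSpace ℝ (Fin d) → ℝ} (hf : Measurable f) (hf0 : ∀ y, 0 ≤ f y) :
    gaussianMean σ (fun y => subsampledDensity s σ a u y * f y) =
      ENNReal.ofReal (1 - s) * gaussianMean σ f +
        ENNReal.ofReal s * gaussianMean σ (fun y => mixtureDensity σ a u y * f y) := by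
  rw [← gaussianMean_const_mul hf (sub_nonneg.2 hs1),
    ← gaussianMean_const_mul (f := fun y => mixtureDensity σ a u y * f y)
      ((measurable_mixtureDensity _ _ _).mul hf) hs0,
    ← gaussianMean_add (hf.const_mul _) (fun y => mul_nonneg (sub_nonneg.2 hs1) (hf0 y))
      (fun y => mul_nonneg hs0 (mul_nonneg (mixtureDensity_pos ha ha1 u y).le (hf0 y)))]
  congr 1
  funext y
  rw [subsampledDensity]
  ring

/-- By convexity of `1/z`, the inverse of a weighted mean is at most the mean of the inverses; and
the inverse of a Gaussian likelihood is, up to a constant, the likelihood of the opposite shift. -/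
theorem inv_subsampledDensity_le {Δ s σ : ℝ} (hs0 : 0 ≤ s) (hs1 : s ≤ 1) {a : H → ℝ}
    (ha : ∀ h, 0 ≤ a h) (ha1 : ∑ h, a h = 1) {u : H → EuclideanSpace ℝ (Fin d)}
    (hu : ∀ h, ‖u h‖ ≤ Δ) (y : EuclideanSpace ℝ (Fin d)) :
    (subsampledDensity s σ a u y)⁻¹ ≤
      Real.exp (Δ ^ 2 / σ ^ 2) * subsampledDensity s σ a (fun h => -u h) y := by
  set p := subsampledDensity s σ a u y with hp
  have hp0 : 0 < p := subsampledDensity_pos hs0 hs1 ha ha1 u y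
  -- The tangent to `1/z` at the mean `p` lies below the graph; averaging it over the components
  -- gives Jensen's inequality.
  have tangent : ∀ z : ℝ, 0 < z → 2 * p⁻¹ - z * p⁻¹ ^ 2 ≤ z⁻¹ := fun z hz => by
    have : z⁻¹ - (2 * p⁻¹ - z * p⁻¹ ^ 2) = z * (z⁻¹ - p⁻¹) ^ 2 := by
      field_simp
      ring
    have := mul_nonneg hz.le (sq_nonneg (z⁻¹ - p⁻¹))
    linarith
  have h1 : p⁻¹ ≤ (1 - s) + s * ∑ h, a h * (gaussianShiftDensity σ (u h) y)⁻¹ := by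
    have hsum : ∑ h, a h * (2 * p⁻¹ - gaussianShiftDensity σ (u h) y * p⁻¹ ^ 2) ≤
        ∑ h, a h * (gaussianShiftDensity σ (u h) y)⁻¹ :=
      Finset.sum_le_sum fun h _ => mul_le_mul_of_nonneg_left
        (tangent _ (gaussianShiftDensity_pos _ _ _)) (ha h)
    have hsum' : ∑ h, a h * (2 * p⁻¹ - gaussianShiftDensity σ (u h) y * p⁻¹ ^ 2) =
        2 * p⁻¹ - mixtureDensity σ a u y * p⁻¹ ^ 2 := by
      simp_rw [mul_sub, ← mul_assoc]
      rw [Finset.sum_sub_distrib, ← Finset.sum_mul, ← Finset.sum_mul, ← Finset.sum_mul, ha1,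
        mixtureDensity]
      ring
    have h2 := mul_le_mul_of_nonneg_left (hsum'.symm.le.trans hsum) hs0
    have h3 := mul_le_mul_of_nonneg_left (tangent 1 one_pos) (sub_nonneg.2 hs1)
    have h4 : (1 - s) * (2 * p⁻¹ - 1 * p⁻¹ ^ 2) +
        s * (2 * p⁻¹ - mixtureDensity σ a u y * p⁻¹ ^ 2) = p⁻¹ := by
      have : s * mixtureDensity σ a u y = p - (1 - s) := by rw [hp, subsampledDensity]; ring
      have h5 : p * p⁻¹ = 1 := mul_inv_cancel₀ hp0.ne'
      linear_combination (-p⁻¹ ^ 2) * this - p⁻¹ * h5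
    rw [inv_one, mul_one] at h3
    linarith
  have h2 : ∑ h, a h * (gaussianShiftDensity σ (u h) y)⁻¹ ≤
      Real.exp (Δ ^ 2 / σ ^ 2) * mixtureDensity σ a (fun h => -u h) y := by
    rw [mixtureDensity, Finset.mul_sum]
    refine Finset.sum_le_sum fun h _ => ?_
    rw [inv_gaussianShiftDensity, mul_left_comm]
    refine mul_le_mul_of_nonneg_right (Real.exp_le_exp.2 ?_)
      (mul_nonneg (ha h) (gaussianShiftDensity_pos _ _ _).le)
    exact div_le_div_of_nonneg_right (pow_le_pow_left₀ (norm_nonneg _) (hu h) 2) (sq_nonneg σ)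
  have h3 := mul_le_mul_of_nonneg_left h2 hs0
  have h4 := mul_le_mul_of_nonneg_right (one_le_exp_sq_div Δ σ) (sub_nonneg.2 hs1)
  rw [subsampledDensity]
  linarith

/-- Division by the density becomes multiplication by the reflected one, hence again averaging over
translates. The pointwise bound `p ≥ 1 - s` would be useless for `s` near 1. -/
theorem gaussianMean_mul_inv_subsampledDensity_le {Δ s σ K : ℝ} (hσ : σ ≠ 0) (hs0 : 0 ≤ s)
    (hs1 : s ≤ 1) {a : H → ℝ} (ha : ∀ h, 0 ≤ a h) (ha1 : ∑ h, a h = 1)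
    {u : H → EuclideanSpace ℝ (Fin d)}
    (hu : ∀ h, ‖u h‖ ≤ Δ) {f : EuclideanSpace ℝ (Fin d) → ℝ} (hf : Measurable f)
    (hf0 : ∀ y, 0 ≤ f y) (hK : 1 ≤ K)
    (hfK : ShiftGrowth Δ K f) :
    gaussianMean σ (fun y => f y * (subsampledDensity s σ a u y)⁻¹) ≤
      ENNReal.ofReal (Real.exp (Δ ^ 2 / σ ^ 2) * K) * gaussianMean σ f := by
  set G := Real.exp (Δ ^ 2 / σ ^ 2) with hG
  have hG0 : 0 ≤ G := (Real.exp_pos _).le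
  have hK0 : 0 ≤ K := zero_le_one.trans hK
  have hu' : ∀ h, ‖-u h‖ ≤ Δ := fun h => (norm_neg _).trans_le (hu h)
  calc gaussianMean σ (fun y => f y * (subsampledDensity s σ a u y)⁻¹)
      ≤ gaussianMean σ (fun y => G * (subsampledDensity s σ a (fun h => -u h) y * f y)) :=
        gaussianMean_mono fun y => by
          rw [← mul_assoc, mul_comm]
          exact mul_le_mul_of_nonneg_right (inv_subsampledDensity_le hs0 hs1 ha ha1 hu y) (hf0 y)
    _ = ENNReal.ofReal G * (ENNReal.ofReal (1 - s) * gaussianMean σ f + ENNReal.ofReal s *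
          gaussianMean σ (fun y => mixtureDensity σ a (fun h => -u h) y * f y)) := by
        rw [gaussianMean_const_mul (f := fun y => subsampledDensity s σ a (fun h => -u h) y * f y)
          ((measurable_subsampledDensity _ _ _ _).mul hf) hG0,
          gaussianMean_subsampledDensity_mul hs0 hs1 ha ha1 _ hf hf0]
    _ ≤ ENNReal.ofReal G * (ENNReal.ofReal (1 - s) * (ENNReal.ofReal K * gaussianMean σ f) +
          ENNReal.ofReal s * (ENNReal.ofReal K * gaussianMean σ f)) := by
        gcongr
        · exact le_mul_of_one_le_left' (by simpa using hK)
        · rw [← gaussianMean_const_mul hf hK0]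
          exact gaussianMean_mixtureDensity_mul_le hσ ha ha1 hu' hf hfK
    _ = ENNReal.ofReal (G * K) * gaussianMean σ f := by
        rw [← add_mul, ← ENNReal.ofReal_add (sub_nonneg.2 hs1) hs0, sub_add_cancel,
          ENNReal.ofReal_one, one_mul, ← mul_assoc, ENNReal.ofReal_mul hG0]

end SubsampledGaussian

/-! ### Moments of the likelihood ratio in one round -/

section SubsampledMoments

open scoped ENNReal

variable {d : ℕ} {H H' : Type*} [Fintype H] [Fintype H']

/-- Bernoulli's inequality is applied to `X⁻¹` for `X = (1 + t)(1 + t')`, together with `1 - X⁻¹ ≤ t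
+ t'`. The result is linear in `t + t'`, with `G` only in the constant. -/
theorem pow_sub_one_le_of_le_mul {t t' G : ℝ} (ht : 0 ≤ t) (ht' : 0 ≤ t') (htG : 1 + t ≤ G)
    (htG' : 1 + t' ≤ G) (n : ℕ) :
    ((1 + t) * (1 + t')) ^ n - 1 ≤ n * G ^ (2 * n) * (t + t') := by
  set X := (1 + t) * (1 + t') with hX
  have hX1 : 1 ≤ X := by nlinarith
  have hX0 : 0 < X := by linarith
  have hXG : X ≤ G ^ 2 := by
    rw [sq]
    exact mul_le_mul htG htG' (by linarith) (by linarith)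
  have hstep : 1 - X⁻¹ ≤ t + t' := by
    have h1 : X * (1 - X⁻¹) = X - 1 := by rw [mul_sub, mul_one, mul_inv_cancel₀ hX0.ne']
    refine le_of_mul_le_mul_left (h1.trans_le ?_) hX0
    nlinarith [mul_nonneg ht ht', mul_nonneg (mul_nonneg ht ht') ht, mul_nonneg (mul_nonneg ht ht') ht', sq_nonneg t, sq_nonneg t']
  have hb := one_add_mul_le_pow (a := X⁻¹ - 1) (by have := inv_pos.2 hX0; linarith) n
  rw [add_sub_cancel, inv_pow] at hb
  have hXn : 0 < X ^ n := pow_pos hX0 n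
  have h1 : X ^ n * (1 + n * (X⁻¹ - 1)) ≤ 1 := by
    calc X ^ n * (1 + n * (X⁻¹ - 1)) ≤ X ^ n * (X ^ n)⁻¹ := mul_le_mul_of_nonneg_left hb hXn.le
      _ = 1 := mul_inv_cancel₀ hXn.ne'
  calc X ^ n - 1 ≤ n * X ^ n * (1 - X⁻¹) := by linarith
    _ ≤ n * X ^ n * (t + t') := mul_le_mul_of_nonneg_left hstep (by positivity)
    _ ≤ n * G ^ (2 * n) * (t + t') := by
      rw [pow_mul]
      gcongr

theorem abs_pow_sub_pow_le_of_le_mul {x z t t' G : ℝ} (hx : 0 < x) (hz : 0 < z) (ht : 0 ≤ t)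
    (ht' : 0 ≤ t') (htG : 1 + t ≤ G) (htG' : 1 + t' ≤ G) (hxz : x ≤ (1 + t) * (1 + t') * z)
    (hzx : z ≤ (1 + t) * (1 + t') * x) (n : ℕ) :
    |x ^ n - z ^ n| ≤ n * G ^ (2 * n) * (t + t') * z ^ n := by
  have h0 := pow_sub_one_le_of_le_mul ht ht' htG htG' n
  set X := (1 + t) * (1 + t') with hX
  have hX0 : 0 < X := by positivity
  have hzn : 0 < z ^ n := pow_pos hz n
  have h1 : x ^ n ≤ X ^ n * z ^ n := (pow_le_pow_left₀ hx.le hxz n).trans_eq (mul_pow _ _ _)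
  have h2 : z ^ n ≤ X ^ n * x ^ n := (pow_le_pow_left₀ hz.le hzx n).trans_eq (mul_pow _ _ _)
  have hXn : 0 < X ^ n := pow_pos hX0 n
  have h3 := mul_le_mul_of_nonneg_right h0 hzn.le
  rw [abs_le]
  refine ⟨?_, by linarith⟩
  have h4 : (X ^ n)⁻¹ * z ^ n ≤ x ^ n := by
    rwa [inv_mul_le_iff₀ hXn]
  have h5 : 1 - (X ^ n)⁻¹ ≤ X ^ n - 1 := by
    have : X ^ n - 1 - (1 - (X ^ n)⁻¹) = (X ^ n - 1) ^ 2 * (X ^ n)⁻¹ := by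
      field_simp
    have : 0 ≤ (X ^ n - 1) ^ 2 * (X ^ n)⁻¹ := by positivity
    linarith
  have h6 := mul_le_mul_of_nonneg_right h5 hzn.le
  linarith

/-- Only the part of weight `s` moves, so the relative change keeps a factor `s`. The cruder bound
by `G` would lose the second factor of sampling probability. -/
theorem affine_le_mul_affine {s G r r' : ℝ} (hs0 : 0 ≤ s) (hp : 0 < 1 - s + s * r)
    (hr : r' ≤ G * r) :
    1 - s + s * r' ≤ (1 + s * (G - 1) * (r * (1 - s + s * r)⁻¹)) * (1 - s + s * r) := by
  rw [add_mul, mul_assoc (s * (G - 1)), inv_mul_cancel_right₀ hp.ne', one_mul]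
  have := mul_le_mul_of_nonneg_left hr hs0
  linarith

/-- The reverse comparison has the same factor, evaluated at the unshifted value `r`; thus one error
function serves all translates. -/
theorem affine_le_mul_affine' {s G r r' : ℝ} (hs0 : 0 ≤ s) (hs1 : s ≤ 1) (hr0 : 0 ≤ r)
    (hG : 1 ≤ G) (hp : 0 < 1 - s + s * r) (hr : r ≤ G * r') :
    1 - s + s * r ≤ (1 + s * (G - 1) * (r * (1 - s + s * r)⁻¹)) * (1 - s + s * r') := by
  set p := 1 - s + s * r with hpdef
  have hsr := mul_le_mul_of_nonneg_left hr hs0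
  have h1 : p ≤ G * (1 - s + s * r') := by
    have := mul_le_mul_of_nonneg_right hG (sub_nonneg.2 hs1)
    linarith
  have h2 : r ≤ G * (r * p⁻¹ * (1 - s + s * r')) := by
    have := mul_le_mul_of_nonneg_left h1 (mul_nonneg hr0 (inv_nonneg.2 hp.le))
    rw [mul_assoc, inv_mul_cancel₀ hp.ne', mul_one] at this
    linarith
  have hG0 : 0 < G := by linarith
  have h3 : (G - 1) * r ≤ G * ((G - 1) * (r * p⁻¹) * (1 - s + s * r')) := by
    have := mul_le_mul_of_nonneg_left h2 (sub_nonneg.2 hG)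
    linarith
  have h4 : G * (s * r - s * r') ≤ s * ((G - 1) * r) := by linarith
  have h5 := mul_le_mul_of_nonneg_left h3 hs0
  have h6 : G * (s * r - s * r') ≤ G * (s * ((G - 1) * (r * p⁻¹) * (1 - s + s * r'))) := by
    linarith
  have h7 := le_of_mul_le_mul_left h6 hG0
  rw [hpdef] at h7 ⊢
  linarith

/-- The `n`-th moment `E_{Q} [(P / Q) ^ n]` of the likelihood ratio of two subsampled Gaussians. -/
def subsampledMoment (s σ : ℝ) (a : H → ℝ) (u : H → EuclideanSpace ℝ (Fin d))
    (a' : H' → ℝ) (u' : H' → EuclideanSpace ℝ (Fin d)) (n : ℕ) : ℝ≥0∞ :=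
  gaussianMean σ fun y => subsampledDensity s σ a' u' y *
    (subsampledDensity s σ a u y * (subsampledDensity s σ a' u' y)⁻¹) ^ n

theorem subsampledMoment_zero {s σ : ℝ} (hσ : σ ≠ 0) (hs0 : 0 ≤ s) (hs1 : s ≤ 1) (a : H → ℝ)
    (u : H → EuclideanSpace ℝ (Fin d)) {a' : H' → ℝ} (ha' : ∀ h, 0 ≤ a' h)
    (ha1' : ∑ h, a' h = 1) (u' : H' → EuclideanSpace ℝ (Fin d)) :
    subsampledMoment s σ a u a' u' 0 = 1 := by
  have h1 : gaussianMean (d := d) σ (fun _ => 1) = 1 := by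
    simp [gaussianMean]
  simp only [subsampledMoment, pow_zero]
  rw [gaussianMean_subsampledDensity_mul hs0 hs1 ha' ha1' u' measurable_const
    (fun _ => zero_le_one), gaussianMean_mixtureDensity_mul hσ ha' ha1' u' measurable_const, h1,
    sum_ofReal_mul_const ha' ha1', mul_one, mul_one,
    ← ENNReal.ofReal_add (sub_nonneg.2 hs1) hs0, sub_add_cancel, ENNReal.ofReal_one]

theorem abs_ratio_pow_shift_sub_le {s σ Δ : ℝ} (hs0 : 0 ≤ s) (hs1 : s ≤ 1)
    {a : H → ℝ} (ha : ∀ h, 0 ≤ a h) (ha1 : ∑ h, a h = 1) {u : H → EuclideanSpace ℝ (Fin d)}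
    (hu : ∀ h, ‖u h‖ ≤ Δ) {a' : H' → ℝ} (ha' : ∀ h, 0 ≤ a' h) (ha1' : ∑ h, a' h = 1)
    {u' : H' → EuclideanSpace ℝ (Fin d)} (hu' : ∀ h, ‖u' h‖ ≤ Δ) (n : ℕ)
    (y v : EuclideanSpace ℝ (Fin d)) (hv : ‖v‖ ≤ Δ) :
    |(subsampledDensity s σ a u (y + v) * (subsampledDensity s σ a' u' (y + v))⁻¹) ^ n -
        (subsampledDensity s σ a u y * (subsampledDensity s σ a' u' y)⁻¹) ^ n| ≤
      n * Real.exp (Δ ^ 2 / σ ^ 2) ^ (2 * n) * (s * (Real.exp (Δ ^ 2 / σ ^ 2) - 1)) *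
        ((mixtureDensity σ a u y * (subsampledDensity s σ a u y)⁻¹ +
          mixtureDensity σ a' u' y * (subsampledDensity s σ a' u' y)⁻¹) *
        (subsampledDensity s σ a u y * (subsampledDensity s σ a' u' y)⁻¹) ^ n) := by
  have hG1 := one_le_exp_sq_div Δ σ
  have hg := shiftGrowth_mixtureDensity (σ := σ) ha hu
  have hg' := shiftGrowth_mixtureDensity (σ := σ) ha' hu'
  set G := Real.exp (Δ ^ 2 / σ ^ 2) with hG
  have hp := subsampledDensity_pos (σ := σ) hs0 hs1 ha ha1 u
  have hp' := subsampledDensity_pos (σ := σ) hs0 hs1 ha' ha1' u'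
  have hR := mixtureDensity_pos (σ := σ) ha ha1 u
  have hR' := mixtureDensity_pos (σ := σ) ha' ha1' u'
  have hback : ∀ {f : EuclideanSpace ℝ (Fin d) → ℝ}, ShiftGrowth Δ G f → f y ≤ G * f (y + v) := by
    intro f hf
    have := hf (y + v) (-v) (by rwa [norm_neg])
    rwa [add_neg_cancel_right] at this
  have e1 := affine_le_mul_affine hs0 (hp y) (hg y v hv)
  have e2 := affine_le_mul_affine' hs0 hs1 (hR y).le hG1 (hp y) (hback hg)
  have e1' := affine_le_mul_affine hs0 (hp' y) (hg' y v hv)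
  have e2' := affine_le_mul_affine' hs0 hs1 (hR' y).le hG1 (hp' y) (hback hg')
  change subsampledDensity s σ a u (y + v) ≤ (1 + s * (G - 1) *
    (mixtureDensity σ a u y * (subsampledDensity s σ a u y)⁻¹)) * subsampledDensity s σ a u y at e1
  change subsampledDensity s σ a u y ≤ (1 + s * (G - 1) * (mixtureDensity σ a u y *
    (subsampledDensity s σ a u y)⁻¹)) * subsampledDensity s σ a u (y + v) at e2
  change subsampledDensity s σ a' u' (y + v) ≤ (1 + s * (G - 1) * (mixtureDensity σ a' u' y *
    (subsampledDensity s σ a' u' y)⁻¹)) * subsampledDensity s σ a' u' y at e1'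
  change subsampledDensity s σ a' u' y ≤ (1 + s * (G - 1) * (mixtureDensity σ a' u' y *
    (subsampledDensity s σ a' u' y)⁻¹)) * subsampledDensity s σ a' u' (y + v) at e2'
  -- The ratio `R/p` itself may be as large as `1/s`; this bound only controls the constants, and
  -- the ratio remains in the error term to be averaged.
  have hsR : ∀ {r : ℝ}, 0 < 1 - s + s * r → s * (r * (1 - s + s * r)⁻¹) ≤ 1 := by
    intro r h
    rw [← mul_assoc, ← div_eq_mul_inv, div_le_one h]
    linarith
  have hψ : s * (mixtureDensity σ a u y * (subsampledDensity s σ a u y)⁻¹) ≤ 1 := hsR (hp y)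
  have hψ' : s * (mixtureDensity σ a' u' y * (subsampledDensity s σ a' u' y)⁻¹) ≤ 1 := hsR (hp' y)
  have hψ0 : 0 ≤ mixtureDensity σ a u y * (subsampledDensity s σ a u y)⁻¹ :=
    mul_nonneg (hR y).le (inv_nonneg.2 (hp y).le)
  have hψ0' : 0 ≤ mixtureDensity σ a' u' y * (subsampledDensity s σ a' u' y)⁻¹ :=
    mul_nonneg (hR' y).le (inv_nonneg.2 (hp' y).le)
  generalize mixtureDensity σ a u y * (subsampledDensity s σ a u y)⁻¹ = ψ at *
  generalize mixtureDensity σ a' u' y * (subsampledDensity s σ a' u' y)⁻¹ = ψ' at *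
  have hG0 : 0 ≤ G - 1 := sub_nonneg.2 hG1
  have ht : 0 ≤ s * (G - 1) * ψ := by positivity
  have ht' : 0 ≤ s * (G - 1) * ψ' := by positivity
  have htG : 1 + s * (G - 1) * ψ ≤ G := by
    have := mul_le_mul_of_nonneg_left hψ hG0
    linarith
  have htG' : 1 + s * (G - 1) * ψ' ≤ G := by
    have := mul_le_mul_of_nonneg_left hψ' hG0
    linarith
  have hdiv : ∀ {p₀ p₁ q₀ q₁ X Y : ℝ}, 0 < q₀ → 0 < q₁ → 0 ≤ X → 0 ≤ p₁ → p₀ ≤ X * p₁ →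
      q₁ ≤ Y * q₀ → p₀ * q₀⁻¹ ≤ X * Y * (p₁ * q₁⁻¹) := by
    intro p₀ p₁ q₀ q₁ X Y h0 h1 hX hp₁ hle hle'
    rw [← div_eq_mul_inv, ← div_eq_mul_inv, ← mul_div_assoc, div_le_div_iff₀ h0 h1]
    calc p₀ * q₁ ≤ (X * p₁) * (Y * q₀) := mul_le_mul hle hle' h1.le (mul_nonneg hX hp₁)
      _ = _ := by ring
  have key := abs_pow_sub_pow_le_of_le_mul (mul_pos (hp (y + v)) (inv_pos.2 (hp' (y + v))))
    (mul_pos (hp y) (inv_pos.2 (hp' y))) ht ht' htG htG'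
    (hdiv (hp' _) (hp' _) (by linarith) (hp _).le e1 e2')
    (hdiv (hp' _) (hp' _) (by linarith) (hp _).le e2 e1') n
  exact key.trans_eq (by ring)

/-- The two moments are means of the same `φ` under P and Q. Their unsampled parts cancel, and the
two mixtures are compared through the plain Gaussian mean of `φ`, at the cost of one error `D` each.
-/
theorem subsampledMoment_succ_le {s σ Δ : ℝ} (hσ : σ ≠ 0) (hs0 : 0 ≤ s) (hs1 : s ≤ 1)
    {a : H → ℝ} (ha : ∀ h, 0 ≤ a h) (ha1 : ∑ h, a h = 1) {u : H → EuclideanSpace ℝ (Fin d)}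
    (hu : ∀ h, ‖u h‖ ≤ Δ) {a' : H' → ℝ} (ha' : ∀ h, 0 ≤ a' h) (ha1' : ∑ h, a' h = 1)
    {u' : H' → EuclideanSpace ℝ (Fin d)} (hu' : ∀ h, ‖u' h‖ ≤ Δ) (n : ℕ) :
    subsampledMoment s σ a u a' u' (n + 1) ≤
      ENNReal.ofReal (1 + 4 * s ^ 2 * n * (Real.exp (Δ ^ 2 / σ ^ 2) - 1) *
        Real.exp (Δ ^ 2 / σ ^ 2) ^ (8 * n + 8)) * subsampledMoment s σ a u a' u' n := by
  have hG1 := one_le_exp_sq_div Δ σ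
  have hdiff := abs_ratio_pow_shift_sub_le (σ := σ) hs0 hs1 ha ha1 hu ha' ha1' hu' n
  have hgp := shiftGrowth_subsampledDensity (σ := σ) hs0 hs1 ha hu
  have hgp' := shiftGrowth_subsampledDensity (σ := σ) hs0 hs1 ha' hu'
  have hinv : ∀ {K : ℝ} {f : EuclideanSpace ℝ (Fin d) → ℝ}, Measurable f → (∀ y, 0 ≤ f y) →
      1 ≤ K → ShiftGrowth Δ K f → _ :=
    fun hf hf0 hK hfK => gaussianMean_mul_inv_subsampledDensity_le hσ hs0 hs1 ha ha1 hu hf hf0 hK hfK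
  have hinv' : ∀ {K : ℝ} {f : EuclideanSpace ℝ (Fin d) → ℝ}, Measurable f → (∀ y, 0 ≤ f y) →
      1 ≤ K → ShiftGrowth Δ K f → _ :=
    fun hf hf0 hK hfK =>
      gaussianMean_mul_inv_subsampledDensity_le hσ hs0 hs1 ha' ha1' hu' hf hf0 hK hfK
  set G := Real.exp (Δ ^ 2 / σ ^ 2) with hG
  have hG0 : 0 < G := Real.exp_pos _
  have hp := subsampledDensity_pos (σ := σ) hs0 hs1 ha ha1 u
  have hp' := subsampledDensity_pos (σ := σ) hs0 hs1 ha' ha1' u'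
  have hR := mixtureDensity_pos (σ := σ) ha ha1 u
  have hR' := mixtureDensity_pos (σ := σ) ha' ha1' u'
  have hmp := measurable_subsampledDensity s σ a u
  have hmp' := measurable_subsampledDensity s σ a' u'
  have hmR := measurable_mixtureDensity σ a u
  have hmR' := measurable_mixtureDensity σ a' u'
  have hsplit : ∀ {f : EuclideanSpace ℝ (Fin d) → ℝ}, Measurable f → (∀ y, 0 ≤ f y) → _ :=
    fun hf hf0 => gaussianMean_subsampledDensity_mul (σ := σ) hs0 hs1 ha ha1 u hf hf0
  have hsplit' : ∀ {f : EuclideanSpace ℝ (Fin d) → ℝ}, Measurable f → (∀ y, 0 ≤ f y) → _ :=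
    fun hf hf0 => gaussianMean_subsampledDensity_mul (σ := σ) hs0 hs1 ha' ha1' u' hf hf0
  have hup : ∀ {f g : EuclideanSpace ℝ (Fin d) → ℝ}, Measurable f →
      (∀ y v, ‖v‖ ≤ Δ → f (y + v) ≤ g y) → _ :=
    fun hf hfg => gaussianMean_mixtureDensity_mul_le hσ ha ha1 hu hf hfg
  have hup' : ∀ {f g : EuclideanSpace ℝ (Fin d) → ℝ}, Measurable f →
      (∀ y v, ‖v‖ ≤ Δ → f (y + v) ≤ g y) → _ :=
    fun hf hfg => gaussianMean_mixtureDensity_mul_le hσ ha' ha1' hu' hf hfg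
  have hlow' : ∀ {f g D : EuclideanSpace ℝ (Fin d) → ℝ}, Measurable f → (∀ y, 0 ≤ f y) →
      (∀ y, 0 ≤ D y) → (∀ y v, ‖v‖ ≤ Δ → g y ≤ f (y + v) + D y) → _ :=
    fun hf hf0 hD hfg => le_gaussianMean_mixtureDensity_mul hσ ha' ha1' hu' hf hf0 hD hfg
  have hJ : subsampledMoment s σ a u a' u' n = gaussianMean σ fun y =>
    subsampledDensity s σ a' u' y *
      (subsampledDensity s σ a u y * (subsampledDensity s σ a' u' y)⁻¹) ^ n := rfl
  have hJ1 : subsampledMoment s σ a u a' u' (n + 1) = gaussianMean σ fun y =>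
      subsampledDensity s σ a u y *
        (subsampledDensity s σ a u y * (subsampledDensity s σ a' u' y)⁻¹) ^ n := by
    rw [subsampledMoment]
    congr 1
    funext y
    have := (hp' y).ne'
    rw [pow_succ']
    field_simp
  rw [hJ1]
  generalize subsampledMoment s σ a u a' u' n = J at *
  clear hJ1
  generalize subsampledDensity s σ a u = p at *
  generalize subsampledDensity s σ a' u' = p' at *
  generalize mixtureDensity σ a u = R at *
  generalize mixtureDensity σ a' u' = R' at *
  set φ : EuclideanSpace ℝ (Fin d) → ℝ := fun y => (p y * (p' y)⁻¹) ^ n with hφ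
  have hφ0 : ∀ y, 0 < φ y := fun y => pow_pos (mul_pos (hp y) (inv_pos.2 (hp' y))) n
  have hmφ : Measurable φ := (hmp.mul hmp'.inv).pow_const n
  have hp0 : ∀ y, 0 ≤ p y := fun y => (hp y).le
  have hp0' : ∀ y, 0 ≤ p' y := fun y => (hp' y).le
  have hpi0 : ∀ y, 0 ≤ (p y)⁻¹ := fun y => inv_nonneg.2 (hp y).le
  have hpi0' : ∀ y, 0 ≤ (p' y)⁻¹ := fun y => inv_nonneg.2 (hp' y).le
  have hgφ : ShiftGrowth Δ ((G * G) ^ n) φ :=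
    (hgp.mul (hgp'.inv hp') hG0.le hp0 hpi0').pow (fun y => mul_nonneg (hp0 y) (hpi0' y)) n
  set f : EuclideanSpace ℝ (Fin d) → ℝ := fun y => p' y * φ y with hf
  have hf0 : ∀ y, 0 ≤ f y := fun y => mul_nonneg (hp0' y) (hφ0 y).le
  have hmf : Measurable f := hmp'.mul hmφ
  have hgf : ShiftGrowth Δ (G ^ (2 * n + 1)) f := by
    have := hgp'.mul hgφ hG0.le hp0' (fun y => (hφ0 y).le)
    rwa [show G * (G * G) ^ n = G ^ (2 * n + 1) by ring] at this
  have hpow : ∀ k : ℕ, 1 ≤ G ^ k := fun k => one_le_pow₀ hG1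
  -- The exponent is (2n+3) + (2n+3) + (2n+2): removing `R`, then `1/p'`, then `1/p`, where each
  -- inverse adds one `G` to the growth of what remains.
  have hA : gaussianMean σ (fun y => R y * (f y * (p y)⁻¹ * (p' y)⁻¹)) ≤
      ENNReal.ofReal (G ^ (6 * n + 8)) * J := by
    have g1 : ShiftGrowth Δ (G ^ (2 * n + 2)) fun y => f y * (p y)⁻¹ :=
      hgf.mul (hgp.inv hp) (by positivity) hf0 hpi0
    have g2 : ShiftGrowth Δ (G ^ (2 * n + 3)) fun y => f y * (p y)⁻¹ * (p' y)⁻¹ :=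
      g1.mul (hgp'.inv hp') (by positivity) (fun y => mul_nonneg (hf0 y) (hpi0 y)) hpi0'
    have m1 : Measurable fun y => f y * (p y)⁻¹ := hmf.mul hmp.inv
    have m2 : Measurable fun y => f y * (p y)⁻¹ * (p' y)⁻¹ := m1.mul hmp'.inv
    refine (hup m2 g2).trans ?_
    rw [gaussianMean_const_mul m2 (by positivity)]
    refine (mul_le_mul_right ((hinv' m1 (fun y => mul_nonneg (hf0 y) (hpi0 y)) (hpow _) g1).trans
      (mul_le_mul_right (hinv hmf hf0 (hpow _) hgf) _)) _).trans_eq ?_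
    rw [← hJ, ← mul_assoc, ← mul_assoc, ← ENNReal.ofReal_mul (by positivity),
      ← ENNReal.ofReal_mul (by positivity)]
    congr 2
    ring
  have hA' : gaussianMean σ (fun y => R' y * (f y * (p' y)⁻¹ * (p' y)⁻¹)) ≤
      ENNReal.ofReal (G ^ (6 * n + 8)) * J := by
    have g1 : ShiftGrowth Δ (G ^ (2 * n + 2)) fun y => f y * (p' y)⁻¹ :=
      hgf.mul (hgp'.inv hp') (by positivity) hf0 hpi0'
    have g2 : ShiftGrowth Δ (G ^ (2 * n + 3)) fun y => f y * (p' y)⁻¹ * (p' y)⁻¹ :=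
      g1.mul (hgp'.inv hp') (by positivity) (fun y => mul_nonneg (hf0 y) (hpi0' y)) hpi0'
    have m1 : Measurable fun y => f y * (p' y)⁻¹ := hmf.mul hmp'.inv
    have m2 : Measurable fun y => f y * (p' y)⁻¹ * (p' y)⁻¹ := m1.mul hmp'.inv
    refine (hup' m2 g2).trans ?_
    rw [gaussianMean_const_mul m2 (by positivity)]
    refine (mul_le_mul_right ((hinv' m1 (fun y => mul_nonneg (hf0 y) (hpi0' y)) (hpow _) g1).trans
      (mul_le_mul_right (hinv' hmf hf0 (hpow _) hgf) _)) _).trans_eq ?_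
    rw [← hJ, ← mul_assoc, ← mul_assoc, ← ENNReal.ofReal_mul (by positivity),
      ← ENNReal.ofReal_mul (by positivity)]
    congr 2
    ring
  set c : ℝ := n * G ^ (2 * n) * (s * (G - 1)) with hc
  have hc0 : 0 ≤ c := by
    have := sub_nonneg.2 hG1
    positivity
  set D : EuclideanSpace ℝ (Fin d) → ℝ := fun y =>
    c * ((R y * (p y)⁻¹ + R' y * (p' y)⁻¹) * φ y) with hD
  have hD0 : ∀ y, 0 ≤ D y := fun y => mul_nonneg hc0 (mul_nonneg (add_nonneg
    (mul_nonneg (hR y).le (hpi0 y)) (mul_nonneg (hR' y).le (hpi0' y))) (hφ0 y).le)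
  have hmD : Measurable D :=
    (((hmR.mul hmp.inv).add (hmR'.mul hmp'.inv)).mul hmφ).const_mul c
  have hED : gaussianMean σ D ≤ ENNReal.ofReal (2 * c * G ^ (6 * n + 8)) * J := by
    have m1 : Measurable fun y => R y * (f y * (p y)⁻¹ * (p' y)⁻¹) :=
      hmR.mul ((hmf.mul hmp.inv).mul hmp'.inv)
    have m2 : Measurable fun y => R' y * (f y * (p' y)⁻¹ * (p' y)⁻¹) :=
      hmR'.mul ((hmf.mul hmp'.inv).mul hmp'.inv)
    -- Writing `φ = f/p'` brings in the integrand `f` of the n-th moment, so that the error is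
    -- bounded relative to `J`.
    have hDe : D = fun y => c * (R y * (f y * (p y)⁻¹ * (p' y)⁻¹) +
        R' y * (f y * (p' y)⁻¹ * (p' y)⁻¹)) := by
      funext y
      have := (hp' y).ne'
      have := (hp y).ne'
      simp only [hD, hf]
      field_simp
    rw [hDe, gaussianMean_const_mul (f := fun y => R y * (f y * (p y)⁻¹ * (p' y)⁻¹) +
      R' y * (f y * (p' y)⁻¹ * (p' y)⁻¹)) (m1.add m2) hc0, gaussianMean_add m1
      (fun y => mul_nonneg (hR y).le (mul_nonneg (mul_nonneg (hf0 y) (hpi0 y)) (hpi0' y)))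
      (fun y => mul_nonneg (hR' y).le (mul_nonneg (mul_nonneg (hf0 y) (hpi0' y)) (hpi0' y)))]
    refine (mul_le_mul_right (add_le_add hA hA') _).trans_eq ?_
    rw [← add_mul, ← ENNReal.ofReal_add (by positivity) (by positivity), ← mul_assoc,
      ← ENNReal.ofReal_mul hc0]
    congr 2
    ring
  have hRφ : gaussianMean σ (fun y => R y * φ y) ≤ gaussianMean σ φ + gaussianMean σ D := by
    rw [← gaussianMean_add hmφ (fun y => (hφ0 y).le) hD0]
    exact hup hmφ fun y v hv => by
      have := (abs_le.1 (hdiff y v hv)).2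
      simp only [hD, hφ] at *
      linarith
  have hφR : gaussianMean σ φ ≤ gaussianMean σ (fun y => R' y * φ y) + gaussianMean σ D :=
    hlow' hmφ (fun y => (hφ0 y).le) hD0 fun y v hv => by
      have := (abs_le.1 (hdiff y v hv)).1
      simp only [hD, hφ] at *
      linarith
  have hs : ENNReal.ofReal (1 - s) + ENNReal.ofReal s = 1 := by
    rw [← ENNReal.ofReal_add (sub_nonneg.2 hs1) hs0, sub_add_cancel, ENNReal.ofReal_one]
  calc gaussianMean σ (fun y => p y * φ y)
      = ENNReal.ofReal (1 - s) * gaussianMean σ φ +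
          ENNReal.ofReal s * gaussianMean σ (fun y => R y * φ y) := hsplit hmφ fun y => (hφ0 y).le
    _ ≤ ENNReal.ofReal (1 - s) * gaussianMean σ φ + ENNReal.ofReal s *
          (gaussianMean σ (fun y => R' y * φ y) + gaussianMean σ D + gaussianMean σ D) := by
        gcongr
        exact hRφ.trans (add_le_add_left hφR _)
    _ = J + ENNReal.ofReal s * (gaussianMean σ D + gaussianMean σ D) := by
        rw [hJ, hsplit' hmφ fun y => (hφ0 y).le]
        ring
    _ ≤ J + ENNReal.ofReal s * (ENNReal.ofReal (2 * c * G ^ (6 * n + 8)) * J +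
          ENNReal.ofReal (2 * c * G ^ (6 * n + 8)) * J) := by gcongr
    _ = _ := by
        have e : 0 ≤ 2 * c * G ^ (6 * n + 8) := by positivity
        have e2 : 1 + 4 * s ^ 2 * n * (G - 1) * G ^ (8 * n + 8) =
            1 + s * (2 * c * G ^ (6 * n + 8) + 2 * c * G ^ (6 * n + 8)) := by
          rw [hc]
          ring
        rw [e2, ENNReal.ofReal_add zero_le_one (by positivity), ENNReal.ofReal_mul hs0,
          ENNReal.ofReal_add e e, ENNReal.ofReal_one]
        ring

theorem subsampledMoment_le {s σ Δ : ℝ} (hσ : σ ≠ 0) (hs0 : 0 ≤ s) (hs1 : s ≤ 1)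
    {a : H → ℝ} (ha : ∀ h, 0 ≤ a h) (ha1 : ∑ h, a h = 1) {u : H → EuclideanSpace ℝ (Fin d)}
    (hu : ∀ h, ‖u h‖ ≤ Δ) {a' : H' → ℝ} (ha' : ∀ h, 0 ≤ a' h) (ha1' : ∑ h, a' h = 1)
    {u' : H' → EuclideanSpace ℝ (Fin d)} (hu' : ∀ h, ‖u' h‖ ≤ Δ) {l : ℕ}
    (hl : 9 * (Δ ^ 2 / σ ^ 2) * l ≤ 1) :
    subsampledMoment s σ a u a' u' l ≤
      ENNReal.ofReal (Real.exp (12 * s ^ 2 * (Δ ^ 2 / σ ^ 2) * l ^ 2)) := by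
  set κ := Δ ^ 2 / σ ^ 2 with hκ
  have hκ0 : 0 ≤ κ := by positivity
  have hn : ∀ n ≤ l, subsampledMoment s σ a u a' u' n ≤
      ENNReal.ofReal (Real.exp (12 * s ^ 2 * κ * l * n)) := by
    intro n
    induction n with
    | zero =>
      intro _
      rw [subsampledMoment_zero hσ hs0 hs1 a u ha' ha1' u']
      simp
    | succ n ih =>
      intro hnl
      refine (subsampledMoment_succ_le hσ hs0 hs1 ha ha1 hu ha' ha1' hu' n).trans
        ((mul_le_mul_right (ih (by lia)) _).trans ?_)
      rw [← ENNReal.ofReal_mul (by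
        have := sub_nonneg.2 (one_le_exp_sq_div Δ σ)
        positivity)]
      refine ENNReal.ofReal_le_ofReal ?_
      have hnl' : (n : ℝ) + 1 ≤ l := by exact_mod_cast hnl
      have hn0 : (0 : ℝ) ≤ n := n.cast_nonneg
      have h1 : (Real.exp κ - 1) * Real.exp κ ^ (8 * n + 8) ≤ 3 * κ := by
        have h2 : Real.exp κ - 1 ≤ κ * Real.exp κ := by
          have := mul_le_mul_of_nonneg_right (Real.add_one_le_exp (-κ)) (Real.exp_pos κ).le
          rw [← Real.exp_add, neg_add_cancel, Real.exp_zero] at this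
          linarith
        -- The exponent is κ(8(n+1) + 1) ≤ 9κl ≤ 1, which explains the 9 in `hl`; the 3 bounds e,
        -- and 4 · 3 gives the 12.
        have h3 : Real.exp κ * Real.exp κ ^ (8 * n + 8) ≤ 3 := by
          rw [← pow_succ', ← Real.exp_nat_mul]
          refine (Real.exp_le_exp.2 ?_).trans (Real.exp_one_lt_three.le)
          push_cast
          have h4 : κ * (8 * n + 8) ≤ κ * (8 * l) := mul_le_mul_of_nonneg_left (by linarith) hκ0
          have h5 : κ * 1 ≤ κ * l := mul_le_mul_of_nonneg_left (by linarith) hκ0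
          linarith
        calc (Real.exp κ - 1) * Real.exp κ ^ (8 * n + 8)
            ≤ κ * Real.exp κ * Real.exp κ ^ (8 * n + 8) := by gcongr
          _ = κ * (Real.exp κ * Real.exp κ ^ (8 * n + 8)) := mul_assoc _ _ _
          _ ≤ κ * 3 := mul_le_mul_of_nonneg_left h3 hκ0
          _ = 3 * κ := mul_comm _ _
      have h6 : 1 + 4 * s ^ 2 * n * (Real.exp κ - 1) * Real.exp κ ^ (8 * n + 8) ≤
          Real.exp (12 * s ^ 2 * κ * l) := by
        refine le_trans ?_ (Real.add_one_le_exp _)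
        have h7 := mul_le_mul_of_nonneg_left h1 (show 0 ≤ 4 * s ^ 2 * n by positivity)
        have h8 : 12 * s ^ 2 * κ * n ≤ 12 * s ^ 2 * κ * l :=
          mul_le_mul_of_nonneg_left (by linarith) (by positivity)
        linarith
      refine (mul_le_mul_of_nonneg_right h6 (Real.exp_pos _).le).trans_eq ?_
      rw [← Real.exp_add]
      congr 1
      push_cast
      ring
  refine (hn l le_rfl).trans_eq ?_
  congr 2
  ring

end SubsampledMoments

/-! ### Composition of rounds with a hidden state -/

section HiddenStateComposition

open scoped ENNReal

/-- The trajectory of a dynamical system with time-dependent, coin-driven steps. -/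
def trajectory {S C : Type*} {T : ℕ} (st : Fin T → C → S → S) (z : S) (c : Fin T → C)
    (t : Fin (T + 1)) : S :=
  Fin.induction (motive := fun _ => S) z (fun s z => st s (c s) z) t

theorem trajectory_zero {S C : Type*} {T : ℕ} (st : Fin T → C → S → S) (z : S) (c : Fin T → C) :
    trajectory st z c 0 = z := rfl

theorem trajectory_succ {S C : Type*} {T : ℕ} (st : Fin T → C → S → S) (z : S) (c : Fin T → C)
    (t : Fin T) : trajectory st z c t.succ = st t (c t) (trajectory st z c t.castSucc) := rfl

/-- The recursion appends a last step, whereas the privacy induction must split off the first one.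
-/
theorem trajectory_cons {S C : Type*} {T : ℕ} (st : Fin (T + 1) → C → S → S) (z : S) (c₀ : C)
    (c : Fin T → C) :
    trajectory st z (Fin.cons c₀ c : Fin (T + 1) → C) =
      (Fin.cons z (trajectory (fun t => st t.succ) (st 0 c₀ z) c) : Fin (T + 2) → S) := by
  funext t
  induction t using Fin.induction with
  | zero => rfl
  | succ t ih =>
    rw [trajectory_succ, ih, Fin.cons_succ]
    induction t using Fin.cases with
    | zero => rfl
    | succ t =>
      rw [Fin.cons_succ, ← Fin.succ_castSucc, Fin.cons_succ, trajectory_succ]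

theorem measurable_trajectory {S C : Type*} [MeasurableSpace S] [MeasurableSpace C] {T : ℕ}
    {st : Fin T → C → S → S} (hst : ∀ t, Measurable fun p : C × S => st t p.1 p.2) :
    Measurable fun p : S × (Fin T → C) => trajectory st p.1 p.2 := by
  refine measurable_pi_lambda _ fun t => ?_
  induction t using Fin.induction with
  | zero => exact measurable_fst
  | succ t ih =>
    exact (hst t).comp (((measurable_pi_apply t).comp measurable_snd).prodMk ih)

theorem lintegral_pi_fin_succ {C : Type*} [MeasurableSpace C] (μ : Measure C) [SigmaFinite μ]
    {T : ℕ} {f : (Fin (T + 1) → C) → ℝ≥0∞} (hf : Measurable f) :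
    ∫⁻ c, f c ∂(Measure.pi fun _ => μ) =
      ∫⁻ c₀, ∫⁻ c, f (Fin.cons c₀ c) ∂(Measure.pi fun _ => μ) ∂μ := by
  have h := ((measurePreserving_piFinSuccAbove (fun _ : Fin (T + 1) => μ) 0).symm).lintegral_comp hf
  rw [← h, lintegral_prod _ (by fun_prop)]
  refine lintegral_congr fun c₀ => lintegral_congr fun c => congrArg f ?_
  exact Fin.insertNth_zero' c₀ c

/-- The expectation of a test function of the public part of a trajectory. -/
def trajectoryMean {S C Y : Type*} [MeasurableSpace C] {T : ℕ} (μ : Measure C) (pub : S → Y)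
    (st : Fin T → C → S → S) (f : (Fin (T + 1) → Y) → ℝ≥0∞) (z : S) : ℝ≥0∞ :=
  ∫⁻ c, f (fun t => pub (trajectory st z c t)) ∂(Measure.pi fun _ => μ)

theorem measurable_trajectoryMean {S C Y : Type*} [MeasurableSpace S] [MeasurableSpace C]
    [MeasurableSpace Y] {T : ℕ} (μ : Measure C) [SigmaFinite μ] {pub : S → Y}
    (hpub : Measurable pub) {st : Fin T → C → S → S}
    (hst : ∀ t, Measurable fun p : C × S => st t p.1 p.2)
    {f : (Fin (T + 1) → Y) → ℝ≥0∞} (hf : Measurable f) :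
    Measurable (trajectoryMean μ pub st f) :=
  Measurable.lintegral_prod_right' (f := fun p : S × (Fin T → C) =>
    f (fun t => pub (trajectory st p.1 p.2 t))) (hf.comp (measurable_pi_lambda _ fun t =>
      hpub.comp ((measurable_pi_apply t).comp (measurable_trajectory hst))))

theorem trajectoryMean_succ {S C Y : Type*} [MeasurableSpace S] [MeasurableSpace C]
    [MeasurableSpace Y] {T : ℕ} (μ : Measure C) [SigmaFinite μ] {pub : S → Y}
    (hpub : Measurable pub) {st : Fin (T + 1) → C → S → S}
    (hst : ∀ t, Measurable fun p : C × S => st t p.1 p.2)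
    {f : (Fin (T + 2) → Y) → ℝ≥0∞} (hf : Measurable f) (z : S) :
    trajectoryMean μ pub st f z =
      ∫⁻ c, trajectoryMean μ pub (fun t => st t.succ)
        (fun τ => f (Fin.cons (pub z) τ : Fin (T + 2) → Y)) (st 0 c z) ∂μ := by
  rw [trajectoryMean, lintegral_pi_fin_succ]
  · refine lintegral_congr fun c₀ => lintegral_congr fun c => ?_
    rw [trajectory_cons]
    congr 1
    funext t
    induction t using Fin.cases with
    | zero => rfl
    | succ t => rfl
  · exact hf.comp (measurable_pi_lambda _ fun t => hpub.comp ((measurable_pi_apply t).comp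
      ((measurable_trajectory hst).comp measurable_prodMk_left)))

/-- The law of a round of a system whose states are made of a public part and of a hidden value:
with probability `1 - q` the hidden value plays no role and is not changed, with probability `q`
it shifts the Gaussian noise by `u` and is updated by `V`. -/
def IsSubsampledRound {S C B X Θ : Type*} [MeasurableSpace S] [MeasurableSpace C]
    [MeasurableSpace B] {d : ℕ} (q σ : ℝ) (μ : Measure C) (ν : Measure B) (mk : X → Θ → S)
    (st : C → S → S) (G : B → EuclideanSpace ℝ (Fin d) → X → X)
    (u : X → Θ → EuclideanSpace ℝ (Fin d)) (V : X → Θ → Θ) : Prop :=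
  ∀ g : S → ℝ≥0∞, Measurable g → ∀ x θ, ∫⁻ c, g (st c (mk x θ)) ∂μ =
    ∫⁻ b, (ENNReal.ofReal (1 - q) *
        ∫⁻ y, g (mk (G b y x) θ) ∂multivariateGaussian 0 (σ ^ 2 • 1) +
      ENNReal.ofReal q *
        ∫⁻ y, g (mk (G b (y + u x θ) x) (V x θ)) ∂multivariateGaussian 0 (σ ^ 2 • 1)) ∂ν

/-- The weights of the hidden states after a round in which the shifted noise is `y`. -/
def updatedWeight {H : Type*} {d : ℕ} (q σ : ℝ) (a : H → ℝ) (u : H → EuclideanSpace ℝ (Fin d))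
    (y : EuclideanSpace ℝ (Fin d)) : H ⊕ H → ℝ :=
  Sum.elim (fun h => a h * (1 - q)) fun h => a h * q * gaussianShiftDensity σ (u h) y

theorem updatedWeight_nonneg {H : Type*} {d : ℕ} {q : ℝ} (σ : ℝ) (hq0 : 0 ≤ q) (hq1 : q ≤ 1)
    {a : H → ℝ} (ha : ∀ h, 0 ≤ a h) (u : H → EuclideanSpace ℝ (Fin d))
    (y : EuclideanSpace ℝ (Fin d)) (h : H ⊕ H) : 0 ≤ updatedWeight q σ a u y h := by
  rcases h with h | h
  · exact mul_nonneg (ha h) (sub_nonneg.2 hq1)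
  · exact mul_nonneg (mul_nonneg (ha h) hq0) (gaussianShiftDensity_pos _ _ _).le

theorem sum_updatedWeight {H : Type*} [Fintype H] {d : ℕ} (q σ : ℝ) (a : H → ℝ)
    (ha : 0 < ∑ h, a h) (u : H → EuclideanSpace ℝ (Fin d)) (y : EuclideanSpace ℝ (Fin d)) :
    ∑ h, updatedWeight q σ a u y h =
      (∑ h, a h) * subsampledDensity q σ (fun h => a h / ∑ h, a h) u y := by
  rw [Fintype.sum_sum_type, subsampledDensity, mixtureDensity, mul_add, Finset.mul_sum,
    Finset.mul_sum]
  simp only [updatedWeight, Sum.elim_inl, Sum.elim_inr]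
  rw [← Finset.sum_mul]
  congr 1
  refine Finset.sum_congr rfl fun h _ => ?_
  have := ha.ne'
  field_simp

/-- Cameron–Martin on each participating branch: afterwards all branches are evaluated at the same
noise `y`, and only their weights and hidden values differ. -/
theorem lintegral_round_eq_lintegral_updatedWeight {H : Type*} [Fintype H] {d : ℕ} {q σ : ℝ}
    (hσ : σ ≠ 0) (hq0 : 0 ≤ q) {a : H → ℝ} (ha : ∀ h, 0 ≤ a h)
    (u : H → EuclideanSpace ℝ (Fin d)) {F : H ⊕ H → EuclideanSpace ℝ (Fin d) → ℝ≥0∞}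
    (hF : ∀ h, Measurable (F h)) :
    ∑ h, ENNReal.ofReal (a h) * (ENNReal.ofReal (1 - q) *
        ∫⁻ y, F (Sum.inl h) y ∂multivariateGaussian 0 (σ ^ 2 • 1) +
      ENNReal.ofReal q *
        ∫⁻ y, F (Sum.inr h) (y + u h) ∂multivariateGaussian 0 (σ ^ 2 • 1)) =
    ∫⁻ y, ∑ h, ENNReal.ofReal (updatedWeight q σ a u y h) * F h y
      ∂multivariateGaussian 0 (σ ^ 2 • 1) := by
  have hm : ∀ h, Measurable fun y => ENNReal.ofReal (updatedWeight q σ a u y h) * F h y := by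
    rintro (h | h)
    · change Measurable fun y => ENNReal.ofReal (a h * (1 - q)) * F _ y
      exact (hF _).const_mul _
    · exact (((measurable_gaussianShiftDensity _ _).const_mul _).ennreal_ofReal).mul (hF _)
  rw [lintegral_finsetSum _ fun h _ => hm h, Fintype.sum_sum_type, ← Finset.sum_add_distrib]
  refine Finset.sum_congr rfl fun h _ => ?_
  simp only [updatedWeight, Sum.elim_inl, Sum.elim_inr]
  rw [lintegral_const_mul _ (hF _), ← lintegral_gaussianShiftDensity_mul hσ _ (hF _)]
  simp_rw [ENNReal.ofReal_mul (mul_nonneg (ha h) hq0), mul_assoc]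
  rw [lintegral_const_mul (f := fun y => ENNReal.ofReal (gaussianShiftDensity σ (u h) y) * F _ y) _
      (((measurable_gaussianShiftDensity _ _).ennreal_ofReal).mul (hF _)),
    ENNReal.ofReal_mul (ha h), ENNReal.ofReal_mul (ha h)]
  ring

/-- Markov's inequality for the privacy loss, in pointwise form: if `m/m'` exceeds e^ε, then its
l-th power pays for the factor e^(-lε). -/
theorem le_exp_mul_add_of_ratio_pow {m m' : ℝ} (hm' : 0 < m') (ε : ℝ) (l : ℕ) :
    m ≤ Real.exp ε * m' ∨ m ≤ Real.exp (-(l * ε)) * (m' * (m * m'⁻¹) ^ (l + 1)) := by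
  refine (le_or_gt m (Real.exp ε * m')).imp_right fun h => ?_
  have h1 : Real.exp ε ≤ m * m'⁻¹ := by
    rw [← div_eq_mul_inv, le_div_iff₀ hm']
    exact h.le
  have hm : 0 < m := (mul_pos (Real.exp_pos _) hm').trans h
  have h2 : Real.exp (l * ε) ≤ (m * m'⁻¹) ^ l := by
    rw [Real.exp_nat_mul]
    exact pow_le_pow_left₀ (Real.exp_pos _).le h1 l
  have h3 : 1 ≤ Real.exp (-(l * ε)) * (m * m'⁻¹) ^ l := by
    have := mul_le_mul_of_nonneg_left h2 (Real.exp_pos (-(l * ε))).le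
    rwa [← Real.exp_add, neg_add_cancel, Real.exp_zero] at this
  calc m = m * 1 := (mul_one m).symm
    _ ≤ m * (Real.exp (-(l * ε)) * (m * m'⁻¹) ^ l) := mul_le_mul_of_nonneg_left h3 hm.le
    _ = _ := by
      rw [pow_succ]
      field_simp

/-- After normalising the weights, the total masses factor out and the one-round moment bound
remains. -/
theorem lintegral_ratio_pow_le {H H' : Type*} [Fintype H] [Fintype H'] {d : ℕ} {q σ Δ : ℝ}
    (hσ : σ ≠ 0) (hq0 : 0 ≤ q) (hq1 : q ≤ 1) {a : H → ℝ} (ha : ∀ h, 0 ≤ a h)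
    (hapos : 0 < ∑ h, a h) {u : H → EuclideanSpace ℝ (Fin d)} (hu : ∀ h, ‖u h‖ ≤ Δ)
    {a' : H' → ℝ} (ha' : ∀ h, 0 ≤ a' h) (hapos' : 0 < ∑ h, a' h)
    {u' : H' → EuclideanSpace ℝ (Fin d)} (hu' : ∀ h, ‖u' h‖ ≤ Δ) {l : ℕ}
    (hl : 9 * (Δ ^ 2 / σ ^ 2) * l ≤ 1) :
    ∫⁻ y, ENNReal.ofReal ((∑ h, updatedWeight q σ a' u' y h) *
        ((∑ h, updatedWeight q σ a u y h) * (∑ h, updatedWeight q σ a' u' y h)⁻¹) ^ l)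
        ∂multivariateGaussian 0 (σ ^ 2 • 1) ≤
      ENNReal.ofReal (Real.exp (12 * q ^ 2 * (Δ ^ 2 / σ ^ 2) * l ^ 2)) *
        ENNReal.ofReal ((∑ h, a' h) * ((∑ h, a h) * (∑ h, a' h)⁻¹) ^ l) := by
  have hn : ∀ h, 0 ≤ a h / ∑ h, a h := fun h => div_nonneg (ha h) hapos.le
  have hn' : ∀ h, 0 ≤ a' h / ∑ h, a' h := fun h => div_nonneg (ha' h) hapos'.le
  have hn1 : ∑ h, a h / ∑ h, a h = 1 := by rw [← Finset.sum_div, div_self hapos.ne']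
  have hn1' : ∑ h, a' h / ∑ h, a' h = 1 := by rw [← Finset.sum_div, div_self hapos'.ne']
  have key := subsampledMoment_le hσ hq0 hq1 hn hn1 hu hn' hn1' hu' hl
  simp_rw [sum_updatedWeight q σ a hapos u, sum_updatedWeight q σ a' hapos' u']
  have hmeas : Measurable fun y => subsampledDensity q σ (fun h => a' h / ∑ h, a' h) u' y *
      (subsampledDensity q σ (fun h => a h / ∑ h, a h) u y *
        (subsampledDensity q σ (fun h => a' h / ∑ h, a' h) u' y)⁻¹) ^ l :=
    (measurable_subsampledDensity _ _ _ _).mul (((measurable_subsampledDensity _ _ _ _).mul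
      (measurable_subsampledDensity _ _ _ _).inv).pow_const l)
  have hfac : ∀ m m' r r' : ℝ, m' * r' * (m * r * (m' * r')⁻¹) ^ l =
      m' * (m * m'⁻¹) ^ l * (r' * (r * r'⁻¹) ^ l) := by
    intro m m' r r'
    rw [mul_inv, show m * r * (m'⁻¹ * r'⁻¹) = (m * m'⁻¹) * (r * r'⁻¹) by ring, mul_pow]
    ring
  simp_rw [hfac]
  have hc : 0 ≤ (∑ h, a' h) * ((∑ h, a h) * (∑ h, a' h)⁻¹) ^ l := by positivity
  have := gaussianMean_const_mul (σ := σ) hmeas hc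
  rw [gaussianMean] at this
  rw [this, mul_comm]
  exact mul_le_mul_left key _

/-- Privacy of the adaptive composition of subsampled Gaussian rounds with hidden states. -/
theorem sum_trajectoryMean_le {S C B X Y Θ : Type*} [MeasurableSpace S] [MeasurableSpace C]
    [MeasurableSpace B] [MeasurableSpace Y] {d : ℕ} {q σ Δ : ℝ} (hσ : σ ≠ 0) (hq0 : 0 ≤ q)
    (hq1 : q ≤ 1) (μ : Measure C) [IsProbabilityMeasure μ] (ν : Measure B)
    [IsProbabilityMeasure ν] {mk : X → Θ → S} {pub : S → Y} (hpub : Measurable pub)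
    (hpubmk : ∀ x θ θ', pub (mk x θ) = pub (mk x θ')) {ε : ℝ} {l : ℕ}
    (hl : 9 * (Δ ^ 2 / σ ^ 2) * (l + 1 : ℕ) ≤ 1) {T : ℕ}
    {st st' : Fin T → C → S → S} (hst : ∀ t, Measurable fun p : C × S => st t p.1 p.2)
    (hst' : ∀ t, Measurable fun p : C × S => st' t p.1 p.2)
    {G : Fin T → B → EuclideanSpace ℝ (Fin d) → X → X}
    (hG : ∀ t x θ, Measurable fun p : B × EuclideanSpace ℝ (Fin d) => mk (G t p.1 p.2 x) θ)
    {u u' : Fin T → X → Θ → EuclideanSpace ℝ (Fin d)} (hu : ∀ t x θ, ‖u t x θ‖ ≤ Δ)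
    (hu' : ∀ t x θ, ‖u' t x θ‖ ≤ Δ) {V V' : Fin T → X → Θ → Θ}
    (hround : ∀ t, IsSubsampledRound q σ μ ν mk (st t) (G t) (u t) (V t))
    (hround' : ∀ t, IsSubsampledRound q σ μ ν mk (st' t) (G t) (u' t) (V' t))
    {f : (Fin (T + 1) → Y) → ℝ≥0∞} (hf : Measurable f) (hf1 : ∀ τ, f τ ≤ 1) (x : X)
    {H H' : Type} [Fintype H] [Fintype H'] {a : H → ℝ} (ha : ∀ h, 0 ≤ a h)
    (hapos : 0 < ∑ h, a h) (θ : H → Θ) {a' : H' → ℝ} (ha' : ∀ h, 0 ≤ a' h)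
    (hapos' : 0 < ∑ h, a' h) (θ' : H' → Θ) :
    ∑ h, ENNReal.ofReal (a h) * trajectoryMean μ pub st f (mk x (θ h)) ≤
      ENNReal.ofReal (Real.exp ε) *
          ∑ h, ENNReal.ofReal (a' h) * trajectoryMean μ pub st' f (mk x (θ' h)) +
        ENNReal.ofReal (Real.exp (-(l * ε))) *
          ENNReal.ofReal (Real.exp (12 * q ^ 2 * (Δ ^ 2 / σ ^ 2) * (l + 1 : ℕ) ^ 2)) ^ T *
          ENNReal.ofReal ((∑ h, a' h) * ((∑ h, a h) * (∑ h, a' h)⁻¹) ^ (l + 1)) := by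
  -- The public state and the families of hidden values must vary: the rest of the run starts from
  -- the new state with twice as many weighted hidden values.
  induction T generalizing x H H' with
  | zero =>
    obtain ⟨h₀⟩ : Nonempty H := by
      by_contra hc
      rw [not_nonempty_iff] at hc
      simp at hapos
    have hmean : ∀ (st : Fin 0 → C → S → S) (θ₁ : Θ), trajectoryMean μ pub st f (mk x θ₁) =
        f (fun _ => pub (mk x (θ h₀))) := by
      intro st θ₁
      have : ∀ c, (fun t => pub (trajectory st (mk x θ₁) c t)) = fun _ => pub (mk x (θ h₀)) := by
        intro c
        funext t
        rw [Subsingleton.elim (α := Fin 1) t 0, trajectory_zero, hpubmk x θ₁ (θ h₀)]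
      rw [trajectoryMean]
      simp_rw [this]
      simp
    simp_rw [hmean]
    rw [← Finset.sum_mul, ← Finset.sum_mul, ← ENNReal.ofReal_sum_of_nonneg fun h _ => ha h,
      ← ENNReal.ofReal_sum_of_nonneg fun h _ => ha' h, pow_zero, mul_one, ← mul_assoc,
      ← ENNReal.ofReal_mul (Real.exp_pos _).le, ← ENNReal.ofReal_mul (Real.exp_pos _).le]
    rcases le_exp_mul_add_of_ratio_pow (m := ∑ h, a h) hapos' ε l with h | h
    · exact (mul_le_mul_left (ENNReal.ofReal_le_ofReal h) _).trans le_self_add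
    · refine le_add_left ?_
      calc _ ≤ ENNReal.ofReal (∑ h, a h) * 1 := mul_le_mul_right (hf1 _) _
        _ ≤ _ := by
          rw [mul_one]
          exact ENNReal.ofReal_le_ofReal h
  | succ T ih =>
    obtain ⟨h₀⟩ : Nonempty H := by
      by_contra hc
      rw [not_nonempty_iff] at hc
      simp at hapos
    -- The first public value is the same for every hidden value and both systems, so it can be
    -- frozen in the test function.
    set f' : (Fin (T + 1) → Y) → ℝ≥0∞ :=
      fun τ => f (Fin.cons (pub (mk x (θ h₀))) τ : Fin (T + 2) → Y) with hf'
    have hmf' : Measurable f' := by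
      refine hf.comp (measurable_pi_lambda _ fun t => ?_)
      induction t using Fin.cases with
      | zero => exact measurable_const
      | succ t => exact measurable_pi_apply t
    set W := trajectoryMean μ pub (fun t => st t.succ) f' with hW
    set W' := trajectoryMean μ pub (fun t => st' t.succ) f' with hW'
    have hmW : Measurable W := measurable_trajectoryMean μ hpub (fun t => hst _) hmf'
    have hmW' : Measurable W' := measurable_trajectoryMean μ hpub (fun t => hst' _) hmf'
    have hsucc : ∀ θ₁, trajectoryMean μ pub st f (mk x θ₁) = _ := fun θ₁ => by
      rw [trajectoryMean_succ μ hpub hst hf, hpubmk x θ₁ (θ h₀), ← hf', ← hW,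
        hround 0 W hmW x θ₁]
    have hsucc' : ∀ θ₁, trajectoryMean μ pub st' f (mk x θ₁) = _ := fun θ₁ => by
      rw [trajectoryMean_succ μ hpub hst' hf, hpubmk x θ₁ (θ h₀), ← hf', ← hW',
        hround' 0 W' hmW' x θ₁]
    simp_rw [hsucc, hsucc']
    set K := ENNReal.ofReal (Real.exp (12 * q ^ 2 * (Δ ^ 2 / σ ^ 2) * (l + 1 : ℕ) ^ 2)) with hK
    have hmb : ∀ {w : S → ℝ≥0∞}, Measurable w → ∀ (v : EuclideanSpace ℝ (Fin d)) (θ₁ : Θ),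
        Measurable fun b => ∫⁻ y, w (mk (G 0 b (y + v) x) θ₁)
          ∂multivariateGaussian 0 (σ ^ 2 • 1) := by
      intro w hw v θ₁
      exact Measurable.lintegral_prod_right' (f := fun p : B × EuclideanSpace ℝ (Fin d) =>
        w (mk (G 0 p.1 (p.2 + v) x) θ₁)) (hw.comp ((hG 0 x θ₁).comp
          (measurable_fst.prodMk (measurable_snd.add_const v))))
    have hmr : ∀ {w : S → ℝ≥0∞}, Measurable w → ∀ (v : EuclideanSpace ℝ (Fin d)) (θ₁ θ₂ : Θ),
        Measurable fun b => ENNReal.ofReal (1 - q) *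
            ∫⁻ y, w (mk (G 0 b y x) θ₁) ∂multivariateGaussian 0 (σ ^ 2 • 1) +
          ENNReal.ofReal q * ∫⁻ y, w (mk (G 0 b (y + v) x) θ₂)
            ∂multivariateGaussian 0 (σ ^ 2 • 1) := by
      intro w hw v θ₁ θ₂
      have h0 := hmb hw 0 θ₁
      simp only [add_zero] at h0
      exact (h0.const_mul _).add ((hmb hw v θ₂).const_mul _)
    simp_rw [← lintegral_const_mul _ (hmr hmW _ _ _), ← lintegral_const_mul _ (hmr hmW' _ _ _)]
    rw [← lintegral_finsetSum _ fun h _ => (hmr hmW _ _ _).const_mul _,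
      ← lintegral_finsetSum _ fun h _ => (hmr hmW' _ _ _).const_mul _,
      ← lintegral_const_mul _ (Finset.measurable_sum _ fun h _ => (hmr hmW' _ _ _).const_mul _)]
    set E := ENNReal.ofReal (Real.exp (-(l * ε))) * K ^ (T + 1) *
          ENNReal.ofReal ((∑ h, a' h) * ((∑ h, a h) * (∑ h, a' h)⁻¹) ^ (l + 1)) with hE
    have hEint : E = ∫⁻ _, E ∂ν := by simp
    rw [hEint, ← lintegral_add_right _ measurable_const]
    -- The estimate holds for each value of `b`, as if the other users' coins were revealed; the
    -- error term is constant in `b`.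
    refine lintegral_mono fun b => ?_
    have hmG : ∀ θ₁, Measurable fun y => mk (G 0 b y x) θ₁ := fun θ₁ =>
      (hG 0 x θ₁).comp measurable_prodMk_left
    have e := lintegral_round_eq_lintegral_updatedWeight hσ hq0 ha (fun h => u 0 x (θ h))
      (F := fun h y => W (mk (G 0 b y x) (Sum.elim θ (fun h => V 0 x (θ h)) h)))
      (fun h => hmW.comp (hmG _))
    have e' := lintegral_round_eq_lintegral_updatedWeight hσ hq0 ha' (fun h => u' 0 x (θ' h))
      (F := fun h y => W' (mk (G 0 b y x) (Sum.elim θ' (fun h => V' 0 x (θ' h)) h)))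
      (fun h => hmW'.comp (hmG _))
    simp only [Sum.elim_inl, Sum.elim_inr] at e e'
    rw [e, e']
    have hpos : ∀ {H : Type} [Fintype H] {a : H → ℝ}, (∀ h, 0 ≤ a h) → 0 < ∑ h, a h →
        ∀ (u : H → EuclideanSpace ℝ (Fin d)) y, 0 < ∑ h, updatedWeight q σ a u y h := by
      intro H _ a ha hapos u y
      rw [sum_updatedWeight q σ a hapos]
      exact mul_pos hapos (subsampledDensity_pos hq0 hq1 (fun h => div_nonneg (ha h) hapos.le)
        (by rw [← Finset.sum_div, div_self hapos.ne']) _ _)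
    have hmw : ∀ {H : Type} [Fintype H] (a : H → ℝ) (u : H → EuclideanSpace ℝ (Fin d)) h,
        Measurable fun y => updatedWeight q σ a u y h := by
      rintro H _ a u (h | h)
      · exact measurable_const
      · exact (measurable_gaussianShiftDensity _ _).const_mul _
    refine (lintegral_mono fun y => ih (fun t => hst _) (fun t => hst' _) (fun t => hG _)
      (fun t => hu _) (fun t => hu' _) (fun t => hround _) (fun t => hround' _) hmf'
      (fun τ => hf1 _) (G 0 b y x)
      (updatedWeight_nonneg σ hq0 hq1 ha _ y) (hpos ha hapos _ y) (Sum.elim θ fun h => V 0 x (θ h))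
      (updatedWeight_nonneg σ hq0 hq1 ha' _ y) (hpos ha' hapos' (fun h => u' 0 x (θ' h)) y)
      (Sum.elim θ' fun h => V' 0 x (θ' h))).trans ?_
    rw [lintegral_add_left]
    · gcongr
      · rw [lintegral_const_mul]
        exact Finset.measurable_sum _ fun h _ =>
          ((hmw a' _ h).ennreal_ofReal).mul (hmW'.comp (hmG _))
      · rw [lintegral_const_mul]
        · refine (mul_le_mul_right (lintegral_ratio_pow_le hσ hq0 hq1 ha hapos
            (fun h => hu 0 x (θ h)) ha' hapos' (fun h => hu' 0 x (θ' h)) hl) _).trans_eq ?_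
          rw [hE, ← hK]
          ring
        · have h1 := Finset.measurable_sum Finset.univ fun h _ =>
            hmw a (fun h => u 0 x (θ h)) h
          have h2 := Finset.measurable_sum Finset.univ fun h _ =>
            hmw a' (fun h => u' 0 x (θ' h)) h
          exact (h2.mul ((h1.mul h2.inv).pow_const _)).ennreal_ofReal
    · exact (Finset.measurable_sum _ fun h _ =>
        ((hmw a' _ h).ennreal_ofReal).mul (hmW'.comp (hmG _))).const_mul _

end HiddenStateComposition

/-! ### Integration over participation bits -/

theorem lintegral_bernoulliMeasure {X : Type*} [MeasurableSpace X] (x y : X) (p : unitInterval)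
    {g : X → ENNReal} (hg : Measurable g) :
    ∫⁻ b, g b ∂bernoulliMeasure x y p =
      ENNReal.ofReal (1 - p) * g y + ENNReal.ofReal p * g x := by
  rw [bernoulliMeasure_def, lintegral_add_measure, lintegral_smul_measure,
    lintegral_smul_measure, lintegral_dirac' _ hg, lintegral_dirac' _ hg, add_comm]
  congr 1
  · rw [ENNReal.smul_def, smul_eq_mul]
    congr 1
    rw [← ENNReal.ofReal_coe_nnreal]
    simp
  · rw [ENNReal.smul_def, smul_eq_mul]
    congr 1
    rw [← ENNReal.ofReal_coe_nnreal]
    simp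

/-- Resampling one independent coordinate preserves the law; this isolates the bit of user `i`. -/
theorem lintegral_pi_eq_lintegral_update {ι : Type*} [Fintype ι] [DecidableEq ι] {X : ι → Type*}
    [∀ i, MeasurableSpace (X i)] (μ : ∀ i, Measure (X i)) [∀ i, IsProbabilityMeasure (μ i)]
    (i : ι) {g : (∀ i, X i) → ENNReal} (hg : Measurable g) :
    ∫⁻ b, g b ∂Measure.pi μ =
      ∫⁻ b, ∫⁻ c, g (Function.update b i c) ∂μ i ∂Measure.pi μ := by
  have hm : Measurable fun b => ∫⁻ c, g (Function.update b i c) ∂μ i :=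
    Measurable.lintegral_prod_right' (f := fun p : (∀ i, X i) × X i =>
      g (Function.update p.1 i p.2)) (hg.comp measurable_update')
  refine lintegral_eq_of_lmarginal_eq {i} hg hm ?_
  rw [lmarginal_singleton, lmarginal_singleton]
  funext x
  simp

/-! ### The algorithm as a system of subsampled rounds -/

namespace PPSGD

variable {N T dw dθ : ℕ} {Ξ : Type*} (A : PPSGD N T dw dθ Ξ)

theorem norm_clip_le (hC : 0 < A.C) (g : EuclideanSpace ℝ (Fin dw)) : ‖A.clip g‖ ≤ A.C := by
  have h1 : 0 < max 1 (‖g‖ / A.C) := lt_max_of_lt_left one_pos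
  rw [clip, norm_smul, norm_inv, Real.norm_of_nonneg h1.le, inv_mul_le_iff₀ h1]
  calc ‖g‖ = ‖g‖ / A.C * A.C := (div_mul_cancel₀ _ hC.ne').symm
    _ ≤ max 1 (‖g‖ / A.C) * A.C := mul_le_mul_of_nonneg_right (le_max_right _ _) hC.le

theorem measurable_clip : Measurable A.clip := by
  unfold clip
  fun_prop

/-- Joint continuity of the function suffices, so no regularity of the gradients of the losses is
needed. -/
theorem measurable_gradient_with_param {E F : Type*} [NormedAddCommGroup E] [InnerProductSpace ℝ E]
    [FiniteDimensional ℝ E] [MeasurableSpace E] [BorelSpace E] [TopologicalSpace F]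
    [MeasurableSpace F] [OpensMeasurableSpace F] [SecondCountableTopology E] {f : F → E → ℝ}
    (hf : Continuous f.uncurry) : Measurable fun p : F × E => ∇ (f p.1) p.2 := by
  have h := measurable_fderiv_with_param ℝ hf
  exact (InnerProductSpace.toDual ℝ E).symm.continuous.measurable.comp h

variable {A}

theorem measurable_gradW (hA : ∀ i ξ, Differentiable ℝ
      (fun p : EuclideanSpace ℝ (Fin dw) × EuclideanSpace ℝ (Fin dθ) => A.loss i p.1 p.2 ξ))
    (i : Fin N) (ξ : Fin (A.m i) → Ξ) :
    Measurable fun p : EuclideanSpace ℝ (Fin dw) × EuclideanSpace ℝ (Fin dθ) =>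
      A.gradW i p.1 p.2 ξ := by
  refine Finset.measurable_sum _ fun k _ => ?_
  exact (measurable_gradient_with_param (f := fun θ w => A.loss i w θ (ξ k))
    ((hA i (ξ k)).continuous.comp continuous_swap)).comp measurable_swap

theorem measurable_gradθ (hA : ∀ i ξ, Differentiable ℝ
      (fun p : EuclideanSpace ℝ (Fin dw) × EuclideanSpace ℝ (Fin dθ) => A.loss i p.1 p.2 ξ))
    (i : Fin N) (ξ : Fin (A.m i) → Ξ) :
    Measurable fun p : EuclideanSpace ℝ (Fin dw) × EuclideanSpace ℝ (Fin dθ) =>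
      A.gradθ i p.1 p.2 ξ := by
  refine Finset.measurable_sum _ fun k _ => ?_
  exact measurable_gradient_with_param (f := fun w θ => A.loss i w θ (ξ k))
    (hA i (ξ k)).continuous

theorem measurable_step (hA : ∀ i ξ, Differentiable ℝ
      (fun p : EuclideanSpace ℝ (Fin dw) × EuclideanSpace ℝ (Fin dθ) => A.loss i p.1 p.2 ξ))
    (ξ : ∀ i, Fin (A.m i) → Ξ) :
    Measurable fun p : ((Fin N → Bool) × EuclideanSpace ℝ (Fin dw)) × A.State =>
      A.step ξ p.1.1 p.1.2 p.2 := by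
  have hz1 : Measurable fun p : ((Fin N → Bool) × EuclideanSpace ℝ (Fin dw)) × A.State => p.2.1 :=
    measurable_fst.comp measurable_snd
  have hz2 : ∀ j, Measurable fun p : ((Fin N → Bool) × EuclideanSpace ℝ (Fin dw)) × A.State =>
      p.2.2 j := fun j => (measurable_pi_apply j).comp (measurable_snd.comp measurable_snd)
  have hζ : Measurable fun p : ((Fin N → Bool) × EuclideanSpace ℝ (Fin dw)) × A.State =>
      p.1.2 := measurable_snd.comp measurable_fst
  have hb : ∀ j, MeasurableSet {p : ((Fin N → Bool) × EuclideanSpace ℝ (Fin dw)) × A.State |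
      p.1.1 j = true} := fun j => by
    have h : Measurable fun p : ((Fin N → Bool) × EuclideanSpace ℝ (Fin dw)) × A.State =>
        p.1.1 j := (measurable_pi_apply j).comp (measurable_fst.comp measurable_fst)
    exact h (measurableSet_singleton true)
  unfold step
  refine Measurable.prodMk ?_ (measurable_pi_lambda _ fun j => ?_)
  · simp_rw [Finset.sum_filter]
    refine hz1.sub (Measurable.const_smul (((Finset.measurable_sum _ fun j _ => ?_).const_smul
      (1 / ((A.q : ℝ) * A.M))).add hζ) (A.α * A.η))
    exact Measurable.ite (hb j) (A.measurable_clip.comp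
      ((measurable_gradW hA j (ξ j)).comp (hz1.prodMk (hz2 j)))) measurable_const
  · exact Measurable.ite (hb j) ((hz2 j).sub (((measurable_gradθ hA j (ξ j)).comp
      (hz1.prodMk (hz2 j))).const_smul (A.η / ((A.q : ℝ) * A.M)))) (hz2 j)

variable (A)

/-- The state `x` with the local model of user `i` replaced by `θ`. -/
def withLocal (i : Fin N) (x : A.State) (θ : EuclideanSpace ℝ (Fin dθ)) : A.State :=
  (x.1, Function.update x.2 i θ)

/-- The part of the state that the users other than `i` see. -/
def publicPart (i : Fin N) (z : A.State) :
    EuclideanSpace ℝ (Fin dw) × ({j : Fin N // j ≠ i} → EuclideanSpace ℝ (Fin dθ)) :=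
  (z.1, fun j => z.2 j)

/-- The contribution of user `i` to the averaged clipped gradient, if the user participates. -/
def contribution (i : Fin N) (ξ : Fin (A.m i) → Ξ) (x : A.State)
    (θ : EuclideanSpace ℝ (Fin dθ)) : EuclideanSpace ℝ (Fin dw) :=
  (1 / ((A.q : ℝ) * A.M)) • A.clip (A.gradW i x.1 θ ξ)

theorem measurable_publicPart (i : Fin N) : Measurable (A.publicPart i) :=
  measurable_fst.prodMk (measurable_pi_lambda _ fun j =>
    (measurable_pi_apply j.1).comp measurable_snd)

theorem publicPart_withLocal (i : Fin N) (x : A.State) (θ : EuclideanSpace ℝ (Fin dθ)) :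
    A.publicPart i (A.withLocal i x θ) = A.publicPart i x := by
  simp only [publicPart, withLocal]
  congr 1
  funext j
  rw [Function.update_of_ne j.2]

theorem measurable_withLocal (i : Fin N) (θ : EuclideanSpace ℝ (Fin dθ)) :
    Measurable fun x => A.withLocal i x θ :=
  measurable_fst.prodMk (measurable_update_left.comp measurable_snd)

theorem norm_contribution_le (hC : 0 < A.C) (i : Fin N) (ξ : Fin (A.m i) → Ξ) (x : A.State)
    (θ : EuclideanSpace ℝ (Fin dθ)) :
    ‖A.contribution i ξ x θ‖ ≤ A.C / ((A.q : ℝ) * A.M) := by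
  have h : 0 ≤ 1 / ((A.q : ℝ) * A.M) :=
    div_nonneg zero_le_one (mul_nonneg A.q.2.1 (Nat.cast_nonneg _))
  rw [contribution, norm_smul, Real.norm_of_nonneg h, div_eq_mul_one_div A.C, mul_comm A.C]
  exact mul_le_mul_of_nonneg_left (A.norm_clip_le hC _) h

theorem step_update_false (i : Fin N) {ξ ξ' : ∀ i, Fin (A.m i) → Ξ} (hξ : ∀ j, j ≠ i → ξ j = ξ' j)
    (b : Fin N → Bool) (y : EuclideanSpace ℝ (Fin dw)) (x : A.State)
    (θ : EuclideanSpace ℝ (Fin dθ)) :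
    A.step ξ' (Function.update b i false) y (A.withLocal i x θ) =
      A.withLocal i (A.step ξ (Function.update b i false) y x) θ := by
  have hne : ∀ j, Function.update b i false j = true → j ≠ i := by
    rintro j hj rfl
    simp at hj
  simp only [step, withLocal]
  congr 1
  · congr 4
    refine Finset.sum_congr rfl fun j hj => ?_
    have hji := hne j (Finset.mem_filter.1 hj).2
    rw [Function.update_of_ne hji, hξ j hji]
  · funext j
    by_cases hji : j = i
    · subst hji
      simp
    · simp only [Function.update_of_ne hji, hξ j hji]

/-- Gradient average and noise enter the update through their sum, so participation of user `i`
amounts to non-participation with shifted noise, apart from the hidden local update. -/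
theorem step_update_true (i : Fin N) {ξ ξ' : ∀ i, Fin (A.m i) → Ξ} (hξ : ∀ j, j ≠ i → ξ j = ξ' j)
    (b : Fin N → Bool) (y : EuclideanSpace ℝ (Fin dw)) (x : A.State)
    (θ : EuclideanSpace ℝ (Fin dθ)) :
    A.step ξ' (Function.update b i true) y (A.withLocal i x θ) =
      A.withLocal i (A.step ξ (Function.update b i false) (y + A.contribution i (ξ' i) x θ) x)
        (θ - (A.η / ((A.q : ℝ) * A.M)) • A.gradθ i x.1 θ (ξ' i)) := by
  have hfilter : (Finset.univ.filter fun j => Function.update b i true j = true) =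
      insert i (Finset.univ.filter fun j => Function.update b i false j = true) := by
    ext j
    by_cases hji : j = i
    · subst hji
      simp
    · simp [hji]
  have hi : i ∉ Finset.univ.filter fun j => Function.update b i false j = true := by simp
  have hsum : ∑ j with Function.update b i true j = true,
        A.clip (A.gradW j x.1 (Function.update x.2 i θ j) (ξ' j)) =
      A.clip (A.gradW i x.1 θ (ξ' i)) + ∑ j with Function.update b i false j = true,
        A.clip (A.gradW j x.1 (x.2 j) (ξ j)) := by
    rw [hfilter, Finset.sum_insert hi, Function.update_self]
    congr 1
    refine Finset.sum_congr rfl fun j hj => ?_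
    have hji : j ≠ i := fun h => hi (h ▸ hj)
    rw [Function.update_of_ne hji, hξ j hji]
  simp only [step, withLocal]
  rw [hsum]
  congr 1
  · rw [contribution, smul_add _ (A.clip _)]
    congr 2
    abel
  · funext j
    by_cases hji : j = i
    · subst hji
      simp
    · simp only [Function.update_of_ne hji, hξ j hji]

/-- The law of the coins of a single round. -/
def roundLaw : Measure ((Fin N → Bool) × EuclideanSpace ℝ (Fin dw)) :=
  (Measure.pi fun _ => bernoulliMeasure true false A.q).prod
    (multivariateGaussian 0 (A.σζ ^ 2 • 1))

instance : IsProbabilityMeasure A.roundLaw := by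
  unfold roundLaw
  infer_instance

theorem isSubsampledRound_step (hA : ∀ i ξ, Differentiable ℝ
      (fun p : EuclideanSpace ℝ (Fin dw) × EuclideanSpace ℝ (Fin dθ) => A.loss i p.1 p.2 ξ))
    (i : Fin N) {ξ ξ' : ∀ i, Fin (A.m i) → Ξ} (hξ : ∀ j, j ≠ i → ξ j = ξ' j) :
    IsSubsampledRound (A.q : ℝ) A.σζ A.roundLaw
      (Measure.pi fun _ => bernoulliMeasure true false A.q) (A.withLocal i)
      (fun c z => A.step ξ' c.1 c.2 z) (fun b y x => A.step ξ (Function.update b i false) y x)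
      (A.contribution i (ξ' i))
      (fun x θ => θ - (A.η / ((A.q : ℝ) * A.M)) • A.gradθ i x.1 θ (ξ' i)) := by
  intro g hg x θ
  have hm : Measurable fun c : (Fin N → Bool) × EuclideanSpace ℝ (Fin dw) =>
      g (A.step ξ' c.1 c.2 (A.withLocal i x θ)) :=
    hg.comp ((measurable_step hA ξ').comp (measurable_id.prodMk measurable_const))
  rw [roundLaw, lintegral_prod _ hm.aemeasurable,
    lintegral_pi_eq_lintegral_update _ i hm.lintegral_prod_right']
  refine lintegral_congr fun b => ?_
  rw [lintegral_bernoulliMeasure _ _ _ (measurable_of_finite _)]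
  simp_rw [A.step_update_false i hξ, A.step_update_true i hξ]

/-- The indicator of an event about what the users other than `i` receive, as a function of the
public parts of the iterates. -/
def viewIndicator (i : Fin N) (E : Set (∀ j : {j : Fin N // j ≠ i}, A.Output j))
    (τ : Fin (T + 1) →
      EuclideanSpace ℝ (Fin dw) × ({j : Fin N // j ≠ i} → EuclideanSpace ℝ (Fin dθ))) : ENNReal :=
  E.indicator 1 fun j => (fun t => (τ t).1, fun t => (τ t).2 j)

theorem measurable_viewIndicator (i : Fin N)
    {E : Set (∀ j : {j : Fin N // j ≠ i}, A.Output j)} (hE : MeasurableSet E) :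
    Measurable (A.viewIndicator i E) := by
  refine (measurable_one.indicator hE).comp (measurable_pi_lambda _ fun j => ?_)
  exact (measurable_pi_lambda _ fun t => measurable_fst.comp (measurable_pi_apply t)).prodMk
    (measurable_pi_lambda _ fun t => (measurable_pi_apply j).comp
      (measurable_snd.comp (measurable_pi_apply t)))

theorem viewIndicator_le_one (i : Fin N) (E : Set (∀ j : {j : Fin N // j ≠ i}, A.Output j))
    (τ) : A.viewIndicator i E τ ≤ 1 :=
  Set.indicator_le_self' (fun _ _ => zero_le_one) _

/-- The coins are regrouped round by round, by a measure-preserving equivalence under which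
`iterate` unfolds to `trajectory`. -/
theorem coinLaw_setOf_eq_trajectoryMean (hA : ∀ i ξ, Differentiable ℝ
      (fun p : EuclideanSpace ℝ (Fin dw) × EuclideanSpace ℝ (Fin dθ) => A.loss i p.1 p.2 ξ))
    (i : Fin N) (D : ∀ i, A.Data i) {E : Set (∀ j : {j : Fin N // j ≠ i}, A.Output j)}
    (hE : MeasurableSet E) (z : A.State) (hz : z = 0) :
    A.coinLaw {ω | (fun j : {j : Fin N // j ≠ i} => A.run D ω j) ∈ E} =
      trajectoryMean A.roundLaw (A.publicPart i) (fun t c z => A.step (fun i => D i t) c.1 c.2 z)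
        (A.viewIndicator i E) z := by
  subst hz
  have hmp := measurePreserving_arrowProdEquivProdArrow (Fin N → Bool)
    (EuclideanSpace ℝ (Fin dw)) (Fin T)
    (fun _ => Measure.pi fun _ : Fin N => bernoulliMeasure true false A.q)
    (fun _ => multivariateGaussian 0 (A.σζ ^ 2 • 1))
  have htraj : Measurable fun c : Fin T → (Fin N → Bool) × EuclideanSpace ℝ (Fin dw) =>
      trajectory (S := A.State) (fun t c z => A.step (fun i => D i t) c.1 c.2 z) 0 c := by
    have h := measurable_trajectory (S := A.State)
      (st := fun t (c : (Fin N → Bool) × EuclideanSpace ℝ (Fin dw)) z =>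
        A.step (fun i => D i t) c.1 c.2 z) fun t => measurable_step hA _
    exact h.comp (measurable_prodMk_left (x := (0 : A.State)))
  have hview : Measurable fun c : Fin T → (Fin N → Bool) × EuclideanSpace ℝ (Fin dw) =>
      fun j : {j : Fin N // j ≠ i} => A.run D (MeasurableEquiv.arrowProdEquivProdArrow _ _ _ c) j :=
    measurable_pi_lambda _ fun j => (measurable_pi_lambda _ fun t =>
      measurable_fst.comp ((measurable_pi_apply t).comp htraj)).prodMk
        (measurable_pi_lambda _ fun t => (measurable_pi_apply j.1).comp
          (measurable_snd.comp ((measurable_pi_apply t).comp htraj)))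
  rw [coinLaw, ← hmp.measure_preimage_equiv]
  exact (lintegral_indicator_one (hview hE)).symm

variable {A}

theorem isJDP_run (hA : ∀ i ξ, Differentiable ℝ
      (fun p : EuclideanSpace ℝ (Fin dw) × EuclideanSpace ℝ (Fin dθ) => A.loss i p.1 p.2 ξ))
    (hC : 0 < A.C) (hσ : A.σζ ≠ 0) {ε δ : ℝ} {l : ℕ}
    (hl : 9 * ((A.C / ((A.q : ℝ) * A.M)) ^ 2 / A.σζ ^ 2) * (l + 1 : ℕ) ≤ 1)
    (hδ : Real.exp (-(l * ε)) * Real.exp (12 * (A.q : ℝ) ^ 2 *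
      ((A.C / ((A.q : ℝ) * A.M)) ^ 2 / A.σζ ^ 2) * (l + 1 : ℕ) ^ 2) ^ T ≤ δ) :
    IsJDP ε δ A.coinLaw A.run := by
  intro i D D' hD E hE
  have hz : A.withLocal i 0 0 = 0 := by
    simp only [withLocal]
    exact Prod.ext rfl (Function.update_eq_self i (0 : Fin N → EuclideanSpace ℝ (Fin dθ)))
  rw [A.coinLaw_setOf_eq_trajectoryMean hA i D hE _ hz,
    A.coinLaw_setOf_eq_trajectoryMean hA i D' hE _ hz]
  have hG : ∀ (t : Fin T) (x : A.State) (θ : EuclideanSpace ℝ (Fin dθ)),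
      Measurable fun p : (Fin N → Bool) × EuclideanSpace ℝ (Fin dw) => A.withLocal i
        (A.step (fun i => D i t) (Function.update p.1 i false) p.2 x) θ := fun t x θ =>
    (A.measurable_withLocal i θ).comp ((measurable_step hA fun i => D i t).comp
      ((((measurable_of_finite fun b : Fin N → Bool => Function.update b i false).comp
        measurable_fst).prodMk measurable_snd).prodMk measurable_const))
  have key := sum_trajectoryMean_le (S := A.State) (X := A.State)
    (Θ := EuclideanSpace ℝ (Fin dθ)) (ε := ε) (l := l) hσ A.q.2.1 A.q.2.2 A.roundLaw
    (Measure.pi fun _ : Fin N => bernoulliMeasure true false A.q) (mk := A.withLocal i)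
    (A.measurable_publicPart i)
    (fun x θ θ' => (A.publicPart_withLocal i x θ).trans (A.publicPart_withLocal i x θ').symm) hl
    (st := fun t c z => A.step (fun i => D i t) c.1 c.2 z)
    (st' := fun t c z => A.step (fun i => D' i t) c.1 c.2 z)
    (fun t => measurable_step hA fun i => D i t) (fun t => measurable_step hA fun i => D' i t)
    (G := fun t b y x => A.step (fun i => D i t) (Function.update b i false) y x) hG
    (u := fun t => A.contribution i (D i t)) (u' := fun t => A.contribution i (D' i t))
    (fun t x θ => A.norm_contribution_le hC i (D i t) x θ)
    (fun t x θ => A.norm_contribution_le hC i (D' i t) x θ)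
    -- Both runs use the public transition built from `D`; this is legitimate since it ignores the
    -- data of user `i`, the only data that differ.
    (fun t => A.isSubsampledRound_step hA i fun _ _ => rfl)
    (fun t => A.isSubsampledRound_step hA i fun j hj => congrFun (hD j hj) t)
    (A.measurable_viewIndicator i hE) (A.viewIndicator_le_one i E) 0 (H := Unit) (H' := Unit)
    (a := fun _ => 1) (fun _ => zero_le_one) (by simp) (fun _ => 0)
    (a' := fun _ => 1) (fun _ => zero_le_one) (by simp) (fun _ => 0)
  simp only [Finset.univ_unique, Finset.sum_singleton, ENNReal.ofReal_one, one_mul, inv_one,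
    one_pow, mul_one] at key
  refine key.trans (add_le_add_right ?_ _)
  rw [← ENNReal.ofReal_pow (Real.exp_pos _).le, ← ENNReal.ofReal_mul (Real.exp_pos _).le]
  exact ENNReal.ofReal_le_ofReal hδ

/-! ### Choice of the constants and of the moment order -/

theorem sq_noise_ratio_le {q C M σ ε L T : ℝ} (hq : 0 < q) (hC : 0 < C) (hM : 0 < M) (hε : 0 < ε)
    (hL : 0 < L) (hT : 0 < T) (hσ : 16 * (C * √(T * L) / (M * ε)) ≤ σ) :
    (C / (q * M)) ^ 2 / σ ^ 2 ≤ ε ^ 2 / (256 * q ^ 2 * T * L) := by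
  have h0 : 0 < 16 * (C * √(T * L) / (M * ε)) := by positivity
  have h1 : (16 * (C * √(T * L) / (M * ε))) ^ 2 ≤ σ ^ 2 := pow_le_pow_left₀ h0.le hσ 2
  have h2 : (16 * (C * √(T * L) / (M * ε))) ^ 2 = 256 * C ^ 2 * (T * L) / (M * ε) ^ 2 := by
    rw [mul_pow, div_pow, mul_pow, Real.sq_sqrt (by positivity)]
    ring
  refine (div_le_div_of_nonneg_left (by positivity) (by positivity) h1).trans_eq ?_
  rw [h2]
  field_simp

theorem exists_moment_order {q κ ε L : ℝ} {T : ℕ} (hq : 0 < q) (hε : 0 < ε) (hεL : ε ≤ L)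
    (hT : 0 < T) (hεT : ε < q ^ 2 * T) (hκ : κ ≤ ε ^ 2 / (256 * q ^ 2 * T * L)) :
    ∃ l : ℕ, 9 * κ * (l + 1 : ℕ) ≤ 1 ∧
      Real.exp (-(l * ε)) * Real.exp (12 * q ^ 2 * κ * (l + 1 : ℕ) ^ 2) ^ T ≤ Real.exp (-L) := by
  have hL : 0 < L := hε.trans_le hεL
  have hT' : (0 : ℝ) < T := by exact_mod_cast hT
  -- Then lε ≥ 2L, while the moment bounds cost at most (12 · 16/256)L ≤ L, which leaves e^(-L). The
  -- estimate l + 1 ≤ 4L/ε uses ε ≤ L to absorb the rounding and the extra 1.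
  refine ⟨⌈2 * L / ε⌉₊, ?_, ?_⟩ <;>
  · have h1 : 2 * L / ε ≤ (⌈2 * L / ε⌉₊ : ℝ) := Nat.le_ceil _
    have h2 : (⌈2 * L / ε⌉₊ : ℝ) < 2 * L / ε + 1 := Nat.ceil_lt_add_one (by positivity)
    generalize ⌈2 * L / ε⌉₊ = l at *
    have h3 : 1 ≤ L / ε := by rwa [one_le_div hε]
    have h4 : ((l + 1 : ℕ) : ℝ) ≤ 4 * (L / ε) := by
      push_cast
      have : 2 * L / ε = 2 * (L / ε) := by ring
      linarith
    generalize hlam : ((l + 1 : ℕ) : ℝ) = lam at *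
    have hlam0 : 0 ≤ lam := hlam ▸ Nat.cast_nonneg _
    first
    | calc 9 * κ * lam ≤ 9 * (ε ^ 2 / (256 * q ^ 2 * T * L)) * (4 * (L / ε)) := by gcongr
        _ = 36 / 256 * (ε / (q ^ 2 * T)) := by
          field_simp
          norm_num
        _ ≤ 36 / 256 * 1 := by
          gcongr
          rw [div_le_one (by positivity)]
          exact hεT.le
        _ ≤ 1 := by norm_num
    | rw [← Real.exp_nat_mul, ← Real.exp_add]
      refine Real.exp_le_exp.2 ?_
      have h5 : 2 * L ≤ l * ε := by rwa [div_le_iff₀ hε] at h1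
      have h6 : T * (12 * q ^ 2 * κ * lam ^ 2) ≤ L := by
        calc T * (12 * q ^ 2 * κ * lam ^ 2)
            ≤ T * (12 * q ^ 2 * (ε ^ 2 / (256 * q ^ 2 * T * L)) * (4 * (L / ε)) ^ 2) := by gcongr
          _ = 192 / 256 * L := by
            field_simp
            norm_num
          _ ≤ L := by linarith
      linarith

end PPSGD

end

theorem theorem3 :
    ∃ c₁ : ℝ, 0 < c₁ ∧ ∃ c₂ : ℝ, 0 < c₂ ∧
      ∀ (N T dw dθ : ℕ) (Ξ : Type*) (A : PPSGD N T dw dθ Ξ) (ε δ : ℝ),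
        (∀ i ξ, Differentiable ℝ
          (fun p : EuclideanSpace ℝ (Fin dw) × EuclideanSpace ℝ (Fin dθ) =>
            A.loss i p.1 p.2 ξ)) →
        (∀ i, 1 ≤ A.m i) →
        0 < A.C →
        0 < δ → δ < 1 →
        0 < ε → ε ≤ Real.log (1 / δ) →
        ε < c₁ * (A.q : ℝ) ^ 2 * T →
        c₂ * (A.C * √(T * Real.log (1 / δ)) / (A.M * ε)) ≤ A.σζ →
        IsJDP ε δ A.coinLaw A.run := by
  refine ⟨1, one_pos, 16, by norm_num, ?_⟩
  intro N T dw dθ Ξ A ε δ hA hm hC hδ _ hε hεL hεT hσ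
  -- Without users M = 0 and the noise condition degenerates, but joint privacy is vacuous.
  rcases isEmpty_or_nonempty (Fin N) with hN | ⟨⟨i₀⟩⟩
  · exact fun i => isEmptyElim i
  rw [one_mul] at hεT
  have hL : 0 < Real.log (1 / δ) := hε.trans_le hεL
  have hq : 0 < (A.q : ℝ) := by
    refine A.q.2.1.lt_of_ne fun h => ?_
    rw [← h] at hεT
    norm_num at hεT
    linarith
  have hT' : (0 : ℝ) < T := pos_of_mul_pos_right (hε.trans hεT) (sq_nonneg _)
  have hT : 0 < T := by exact_mod_cast hT'
  have hM : (0 : ℝ) < A.M := by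
    have : A.m i₀ ≤ A.M := Finset.single_le_sum (fun _ _ => Nat.zero_le _) (Finset.mem_univ i₀)
    exact_mod_cast (hm i₀).trans this
  have hσ0 : A.σζ ≠ 0 := by
    have : 0 < 16 * (A.C * √(T * Real.log (1 / δ)) / (A.M * ε)) := by positivity
    exact (this.trans_le hσ).ne'
  obtain ⟨l, hl, hle⟩ := PPSGD.exists_moment_order hq hε hεL hT hεT
    (PPSGD.sq_noise_ratio_le hq hC hM hε hL hT' hσ)
  refine PPSGD.isJDP_run hA hC hσ0 hl (hle.trans_eq ?_)
  rw [Real.log_div one_ne_zero hδ.ne', Real.log_one, zero_sub, neg_neg, Real.exp_log hδ]
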